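/- Let $c_0>0$. For $\alpha\in[0,1]$ put $\beta=\sqrt{1-\alpha^2}$, and let $\vec m_\alpha,\vec n_\alpha,\vec b_\alpha:\mathbb R\to\mathbb R^3$ be the solution of the Serret--Frenet system $$\vec m'=c\,\vec n,\qquad \vec n'=-c\,\vec m+\tau\,\vec b,\qquad \vec b'=-\tau\,\vec n,\qquad c(s)=c_0e^{-\alpha s^2/4},\quad \tau(s)=\frac{\beta s}{2},$$ with $\vec m_\alpha(0)=(1,0,0)$, $\vec n_\alpha(0)=(0,1,0)$, $\vec b_\alpha(0)=(0,0,1)$. Then: (i) (Symmetries) For every $\alpha\in[0,1]$, $m_{1,\alpha}$ is even and $m_{2,\alpha},m_{3,\alpha}$ are odd; $n_{1,\alpha}$ and $b_{1,\alpha}$ are odd, while $n_{2,\alpha},n_{3,\alpha},b_{2,\alpha},b_{3,\alpha}$ are even. (ii) (Asymptotics) Let $s_0=4\sqrt{8+c_0^2}$. There is a constant $C>0$ depending only on $c_0$ such that, for every $\alpha\in[0,1]$, there are a unit vector $\vec A^+_\alpha=(A_{j,\alpha})_{j=1}^3\in\mathbb R^3$ and constants $a_{1,\alpha},a_{2,\alpha},a_{3,\alpha}\in[0,2\pi)$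 such that, with $$\vec B^+_\alpha=\big((1-A_{j,\alpha}^2)^{1/2}\big)_{j=1}^3,\qquad \phi_j(s)=a_{j,\alpha}+\beta\int_{s_0^2/4}^{s^2/4}\sqrt{1+c_0^2\frac{e^{-2\alpha\sigma}}{\sigma}}\,d\sigma ,$$ and with $\vec B^+_\alpha\sin\vec\phi$, $\vec B^+_\alpha\cos\vec\phi$ understood componentwise, for all $s\ge s_0$ $$\vec m_\alpha(s)=\vec A^+_\alpha-\frac{2c_0}{s}\vec B^+_\alpha e^{-\alpha s^2/4}\big(\alpha\sin\vec\phi(s)+\beta\cos\vec\phi(s)\big)-\frac{2c_0^2}{s^2}\vec A^+_\alpha e^{-\alpha s^2/2}+\vec R_m(s,\alpha),$$ $$\vec n_\alpha(s)=\vec B^+_\alpha\sin\vec\phi(s)+\frac{2c_0}{s}\vec A^+_\alpha\,\alpha e^{-\alpha s^2/4}+\vec R_n(s,\alpha),$$ $$\vec b_\alpha(s)=\vec B^+_\alpha\cos\vec\phi(s)+\frac{2c_0}{s}\vec A^+_\alpha\,\beta e^{-\alpha s^2/4}+\vec R_b(s,\alpha),$$ where $$|\vec R_m(s,\alpha)|\le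 C\frac{e^{-\alpha s^2/4}}{s^3},\qquad |\vec R_n(s,\alpha)|\le C\frac{e^{-\alpha s^2/4}}{s^2},\qquad |\vec R_b(s,\alpha)|\le C\frac{e^{-\alpha s^2/4}}{s^2}.$$ Moreover, $\vec A^+_\alpha$, $\vec B^+_\alpha$, $B_{j,\alpha}\sin(a_{j,\alpha})$ and $B_{j,\alpha}\cos(a_{j,\alpha})$ ($j=1,2,3$) and, for each fixed $s\ge s_0$, the error terms $\vec R_m(s,\alpha),\vec R_n(s,\alpha),\vec R_b(s,\alpha)$ depend continuously on $\alpha\in[0,1]$. -/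

import Mathlib

namespace LLG

/-- Euclidean three-space. -/
abbrev E3 : Type := EuclideanSpace ℝ (Fin 3)

/-- The exchange constant `β ≥ 0` determined by `α ^ 2 + β ^ 2 = 1`. -/
noncomputable def beta (α : ℝ) : ℝ := Real.sqrt (1 - α ^ 2)

/-- The curvature `c(s) = c₀ exp (- α s² / 4)`. -/
noncomputable def curvature (c₀ α s : ℝ) : ℝ := c₀ * Real.exp (-(α * s ^ 2) / 4)

/-- The torsion `τ(s) = β s / 2`. -/
noncomputable def torsion (α s : ℝ) : ℝ := beta α * s / 2

/-- `(m, n, b)` solves on all of `ℝ` the Serret-Frenet system with the above curvature and torsion,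
and is the canonical basis at `s = 0`. -/
structure IsFrenetSolution (c₀ α : ℝ) (m n b : ℝ → E3) : Prop where
  deriv_m : ∀ s, HasDerivAt m (curvature c₀ α s • n s) s
  deriv_n : ∀ s, HasDerivAt n (-(curvature c₀ α s • m s) + torsion α s • b s) s
  deriv_b : ∀ s, HasDerivAt b (-(torsion α s • n s)) s
  init_m : m 0 = !₂[1, 0, 0]
  init_n : n 0 = !₂[0, 1, 0]
  init_b : b 0 = !₂[0, 0, 1]

/-- The threshold `s₀ = 4 √(8 + c₀²)`. -/
noncomputable def sZero (c₀ : ℝ) : ℝ := 4 * Real.sqrt (8 + c₀ ^ 2)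

/-- The phase `φ(s) = a + β ∫_{s₀²/4}^{s²/4} √(1 + c₀² exp (-2ασ) / σ) dσ`. -/
noncomputable def phase (c₀ α a s : ℝ) : ℝ :=
  a + beta α * ∫ σ in ((sZero c₀) ^ 2 / 4)..(s ^ 2 / 4),
    Real.sqrt (1 + c₀ ^ 2 * (Real.exp (-(2 * α * σ)) / σ))

/-- The vector `B` with components `(1 - A_j²)^{1/2}`. -/
noncomputable def amplitude (A : E3) : E3 := WithLp.toLp 2 fun j => Real.sqrt (1 - A j ^ 2)

/-- The componentwise product `B sin(φ(s))`; the components of the phase differ by `a_j`. -/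
noncomputable def ampSin (c₀ α : ℝ) (A a : E3) (s : ℝ) : E3 :=
  WithLp.toLp 2 fun j => amplitude A j * Real.sin (phase c₀ α (a j) s)

/-- The componentwise product `B cos(φ(s))`. -/
noncomputable def ampCos (c₀ α : ℝ) (A a : E3) (s : ℝ) : E3 :=
  WithLp.toLp 2 fun j => amplitude A j * Real.cos (phase c₀ α (a j) s)

/-- The explicit part of the expansion of `m`. -/
noncomputable def mainM (c₀ α : ℝ) (A a : E3) (s : ℝ) : E3 :=
  A - (2 * c₀ / s * Real.exp (-(α * s ^ 2) / 4)) •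
        (α • ampSin c₀ α A a s + beta α • ampCos c₀ α A a s)
    - (2 * c₀ ^ 2 / s ^ 2 * Real.exp (-(α * s ^ 2) / 2)) • A

/-- The explicit part of the expansion of `n`. -/
noncomputable def mainN (c₀ α : ℝ) (A a : E3) (s : ℝ) : E3 :=
  ampSin c₀ α A a s + (2 * c₀ / s * α * Real.exp (-(α * s ^ 2) / 4)) • A

/-- The explicit part of the expansion of `b`. -/
noncomputable def mainB (c₀ α : ℝ) (A a : E3) (s : ℝ) : E3 :=
  ampCos c₀ α A a s + (2 * c₀ / s * beta α * Real.exp (-(α * s ^ 2) / 4)) • A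

end LLG

namespace LLG

open Filter Topology Set

/-! The `j`-th components (m, n, b) of the frame solve a scalar system with skew-symmetric
coefficients. Products of two solutions are therefore conserved. This one fact gives uniqueness,
hence the symmetries by reflection s ↦ -s, and also m² + n² + b² = 1 in each component,
orthonormality of the frame, and continuity in α at fixed s.

The asymptotics come from repeated integration by parts. Explicit terms of size c/s and smaller are
added to m and to w = b + i n so that every slowly decaying term of the derivative cancels
(`modTangent`, `modNormal`). The remainder is dominated by the derivative of K c s^{-k}, with k = 3
for the tangent and k = 2 for the normals, and `exists_limit_of_norm_deriv_le` turns this into a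
limit with that function as rate. Uniformity in α rests on c' = -(α s/2) c: the derivative of c
s^{-k} contains both α c s^{1-k} and c s^{-k-1}. Remainder terms with the weaker decay always carry
a factor α, so the first of these absorbs them with a constant depending on c₀ only.

For w, the equation w' = i(β s/2) w - i c m produces after one correction the resonant rotation
iβ(c²/s) w, which is not integrable at α = 0. It cannot be removed by a correction and belongs to
the phase: the square root in `phase` has speed β s/2 + β c²/s up to an integrable error. Thus
e^{-iφ} times the corrected w converges to some Z, and |Z|² = 1 - A², so Z = B e^{ia}. Feeding each
expansion into the other (`exists_hasAsymptotics`) gives the stated form. The rates are uniform in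
α, so A and Z are uniform limits of continuous functions of α. -/

/-! ### Scalar Frenet systems: conserved products, uniqueness and symmetries. -/

/-- One scalar component of the Serret-Frenet system. -/
structure IsScalarFrenet (c₀ α : ℝ) (x y z : ℝ → ℝ) : Prop where
  deriv_x : ∀ s, HasDerivAt x (curvature c₀ α s * y s) s
  deriv_y : ∀ s, HasDerivAt y (-(curvature c₀ α s * x s) + torsion α s * z s) s
  deriv_z : ∀ s, HasDerivAt z (-(torsion α s * y s)) s

lemma hasDerivAt_apply {f : ℝ → E3} {f' : E3} {s : ℝ} (h : HasDerivAt f f' s) (j : Fin 3) :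
    HasDerivAt (fun u => f u j) (f' j) s :=
  ((EuclideanSpace.proj (𝕜 := ℝ) j).hasFDerivAt.comp_hasDerivAt s h :)

lemma IsFrenetSolution.component {c₀ α : ℝ} {m n b : ℝ → E3} (h : IsFrenetSolution c₀ α m n b)
    (j : Fin 3) :
    IsScalarFrenet c₀ α (fun s => m s j) (fun s => n s j) (fun s => b s j) where
  deriv_x s := by simpa using hasDerivAt_apply (h.deriv_m s) j
  deriv_y s := by simpa using hasDerivAt_apply (h.deriv_n s) j
  deriv_z s := by simpa using hasDerivAt_apply (h.deriv_b s) j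

lemma curvature_neg (c₀ α s : ℝ) : curvature c₀ α (-s) = curvature c₀ α s := by
  simp [curvature]

lemma torsion_neg (α s : ℝ) : torsion α (-s) = -torsion α s := by
  simp [torsion]; ring

namespace IsScalarFrenet

variable {c₀ α c₁ α' : ℝ} {x y z x' y' z' : ℝ → ℝ}

/-- Both coefficient matrices are skew-symmetric, so only their difference survives. Equal
parameters give a conservation law, different ones give continuous dependence. -/
lemma hasDerivAt_dot (h : IsScalarFrenet c₀ α x y z) (h' : IsScalarFrenet c₁ α' x' y' z') (s : ℝ) :
    HasDerivAt (fun s => x s * x' s + y s * y' s + z s * z' s)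
      ((curvature c₀ α s - curvature c₁ α' s) * (y s * x' s - x s * y' s)
        + (torsion α s - torsion α' s) * (z s * y' s - y s * z' s)) s := by
  refine ((((h.deriv_x s).mul (h'.deriv_x s)).add ((h.deriv_y s).mul (h'.deriv_y s))).add
    ((h.deriv_z s).mul (h'.deriv_z s))).congr_deriv ?_
  ring

lemma dot_eq (h : IsScalarFrenet c₀ α x y z) (h' : IsScalarFrenet c₀ α x' y' z') (s : ℝ) :
    x s * x' s + y s * y' s + z s * z' s = x 0 * x' 0 + y 0 * y' 0 + z 0 * z' 0 :=
  is_const_of_deriv_eq_zero (fun u => (h.hasDerivAt_dot h' u).differentiableAt)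
    (fun u => by rw [(h.hasDerivAt_dot h' u).deriv]; ring) s 0

lemma sub (h : IsScalarFrenet c₀ α x y z) (h' : IsScalarFrenet c₀ α x' y' z') :
    IsScalarFrenet c₀ α (fun s => x s - x' s) (fun s => y s - y' s) (fun s => z s - z' s) where
  deriv_x s := ((h.deriv_x s).sub (h'.deriv_x s)).congr_deriv (by ring)
  deriv_y s := ((h.deriv_y s).sub (h'.deriv_y s)).congr_deriv (by ring)
  deriv_z s := ((h.deriv_z s).sub (h'.deriv_z s)).congr_deriv (by ring)

lemma neg (h : IsScalarFrenet c₀ α x y z) :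
    IsScalarFrenet c₀ α (fun s => -x s) (fun s => -y s) (fun s => -z s) where
  deriv_x s := (h.deriv_x s).neg.congr_deriv (by ring)
  deriv_y s := (h.deriv_y s).neg.congr_deriv (by ring)
  deriv_z s := (h.deriv_z s).neg.congr_deriv (by ring)

/-- This works because the curvature is even and the torsion is odd. -/
lemma reflect (h : IsScalarFrenet c₀ α x y z) :
    IsScalarFrenet c₀ α (fun s => x (-s)) (fun s => -y (-s)) (fun s => -z (-s)) where
  deriv_x s := by
    have := (h.deriv_x (-s)).comp s (hasDerivAt_neg s)
    refine this.congr_deriv ?_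
    rw [curvature_neg]; ring
  deriv_y s := by
    have := ((h.deriv_y (-s)).comp s (hasDerivAt_neg s)).neg
    refine this.congr_deriv ?_
    rw [curvature_neg, torsion_neg]; ring
  deriv_z s := by
    have := ((h.deriv_z (-s)).comp s (hasDerivAt_neg s)).neg
    refine this.congr_deriv ?_
    rw [torsion_neg]; ring

/-- The difference is again a solution, so its squared length keeps the value 0 that it has at the
origin. -/
lemma unique (h : IsScalarFrenet c₀ α x y z) (h' : IsScalarFrenet c₀ α x' y' z')
    (hx : x 0 = x' 0) (hy : y 0 = y' 0) (hz : z 0 = z' 0) (s : ℝ) :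
    x s = x' s ∧ y s = y' s ∧ z s = z' s := by
  have e := (h.sub h').dot_eq (h.sub h') s
  simp only [hx, hy, hz, sub_self, mul_zero, add_zero] at e
  refine ⟨?_, ?_, ?_⟩ <;> nlinarith [mul_self_nonneg (x s - x' s), mul_self_nonneg (y s - y' s),
    mul_self_nonneg (z s - z' s)]

lemma even_odd_odd (h : IsScalarFrenet c₀ α x y z) (hy : y 0 = 0) (hz : z 0 = 0) :
    Function.Even x ∧ Function.Odd y ∧ Function.Odd z := by
  have := h.unique h.reflect (by simp) (by simp [hy]) (by simp [hz])
  refine ⟨fun s => (this s).1.symm, fun s => ?_, fun s => ?_⟩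
  · linarith [(this s).2.1]
  · linarith [(this s).2.2]

lemma odd_even_even (h : IsScalarFrenet c₀ α x y z) (hx : x 0 = 0) :
    Function.Odd x ∧ Function.Even y ∧ Function.Even z := by
  have := h.unique h.reflect.neg (by simp [hx]) (by simp) (by simp)
  refine ⟨fun s => ?_, fun s => ?_, fun s => ?_⟩
  · linarith [(this s).1]
  · linarith [(this s).2.1]
  · linarith [(this s).2.2]

/-- Two unit solutions with the same data at the origin but different parameters. -/
lemma dist_sq_le (h : IsScalarFrenet c₀ α x y z) (h' : IsScalarFrenet c₁ α' x' y' z')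
    (hu : ∀ s, x s ^ 2 + y s ^ 2 + z s ^ 2 = 1) (hu' : ∀ s, x' s ^ 2 + y' s ^ 2 + z' s ^ 2 = 1)
    (hx : x 0 = x' 0) (hy : y 0 = y' 0) (hz : z 0 = z' 0) {s K : ℝ} (hs : 0 ≤ s)
    (hK : ∀ u ∈ Icc 0 s, |curvature c₀ α u - curvature c₁ α' u| + |torsion α u - torsion α' u| ≤ K) :
    (x s - x' s) ^ 2 + (y s - y' s) ^ 2 + (z s - z' s) ^ 2 ≤ 2 * K * s := by
  have key : ∀ u ∈ Icc 0 s, ‖(curvature c₀ α u - curvature c₁ α' u) * (y u * x' u - x u * y' u)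
        + (torsion α u - torsion α' u) * (z u * y' u - y u * z' u)‖ ≤ K := by
    intro u hu1
    have h1 : |y u * x' u - x u * y' u| ≤ 1 := by
      rw [abs_le]; constructor <;> nlinarith [hu u, hu' u, sq_nonneg (y u - x' u),
        sq_nonneg (y u + x' u), sq_nonneg (x u - y' u), sq_nonneg (x u + y' u), sq_nonneg (z u),
        sq_nonneg (z' u)]
    have h2 : |z u * y' u - y u * z' u| ≤ 1 := by
      rw [abs_le]; constructor <;> nlinarith [hu u, hu' u, sq_nonneg (z u - y' u),
        sq_nonneg (z u + y' u), sq_nonneg (y u - z' u), sq_nonneg (y u + z' u), sq_nonneg (x u),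
        sq_nonneg (x' u)]
    rw [Real.norm_eq_abs]
    refine (abs_add_le _ _).trans (le_trans ?_ (hK u hu1))
    rw [abs_mul, abs_mul]
    exact add_le_add (mul_le_of_le_one_right (abs_nonneg _) h1)
      (mul_le_of_le_one_right (abs_nonneg _) h2)
  have e := (convex_Icc 0 s).norm_image_sub_le_of_norm_hasDerivWithin_le
    (fun u _ => (h.hasDerivAt_dot h' u).hasDerivWithinAt) key
    (left_mem_Icc.2 hs) (right_mem_Icc.2 hs)
  have e0 : x 0 * x' 0 + y 0 * y' 0 + z 0 * z' 0 = 1 := by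
    rw [← hx, ← hy, ← hz, ← hu 0]; ring
  rw [e0, sub_zero, Real.norm_eq_abs, Real.norm_eq_abs, abs_of_nonneg hs] at e
  -- For unit vectors the squared distance is 2 - 2 ⟨·,·⟩, and the product has moved at most `K * s`
  -- away from 1.
  nlinarith [(abs_le.1 e).1, hu s, hu' s]

end IsScalarFrenet

/-! ### Unit length of the frame and continuity in α at fixed s. -/

lemma continuous_beta : Continuous beta := by unfold beta; fun_prop

lemma beta_nonneg (α : ℝ) : 0 ≤ beta α := Real.sqrt_nonneg _

lemma sq_add_beta_sq {α : ℝ} (hα : α ∈ Icc (0 : ℝ) 1) : α ^ 2 + beta α ^ 2 = 1 := by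
  rw [beta, Real.sq_sqrt (by nlinarith [hα.1, hα.2])]; ring

lemma beta_le_one (α : ℝ) : beta α ≤ 1 := by
  rw [beta, Real.sqrt_le_left zero_le_one]; nlinarith [sq_nonneg α]

lemma exp_neg_sub_le {u v : ℝ} (hu : 0 ≤ u) (hv : 0 ≤ v) :
    |Real.exp (-u) - Real.exp (-v)| ≤ |u - v| := by
  wlog huv : u ≤ v generalizing u v
  · rw [abs_sub_comm, abs_sub_comm u]; exact this hv hu (le_of_not_ge huv)
  have h1 : Real.exp (-v) = Real.exp (-u) * Real.exp (u - v) := by rw [← Real.exp_add]; ring_nf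
  have h2 := Real.add_one_le_exp (u - v)
  have h3 : Real.exp (u - v) ≤ 1 := Real.exp_le_one_iff.2 (by linarith)
  have h4 : Real.exp (-u) ≤ 1 := Real.exp_le_one_iff.2 (by linarith)
  have h5 := Real.exp_pos (-u)
  rw [abs_of_nonpos (sub_nonpos.2 huv), h1, abs_of_nonneg (by nlinarith)]
  nlinarith

lemma IsFrenetSolution.unit_component {c₀ α : ℝ} {m n b : ℝ → E3}
    (h : IsFrenetSolution c₀ α m n b) (j : Fin 3) (s : ℝ) :
    m s j ^ 2 + n s j ^ 2 + b s j ^ 2 = 1 := by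
  have e := (h.component j).dot_eq (h.component j) s
  simp only [h.init_m, h.init_n, h.init_b, ← sq] at e
  rw [e]
  fin_cases j <;> simp

/-- The conserved products say that the columns of the frame matrix are orthonormal; for a square
matrix the rows are then orthonormal too, and m is a row. -/
lemma IsFrenetSolution.norm_m {c₀ α : ℝ} {m n b : ℝ → E3}
    (h : IsFrenetSolution c₀ α m n b) (s : ℝ) : ‖m s‖ = 1 := by
  have e : ∀ j k, m s j * m s k + n s j * n s k + b s j * b s k = (1 : Matrix _ _ ℝ) j k := by
    intro j k
    have e := (h.component j).dot_eq (h.component k) s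
    simp only [h.init_m, h.init_n, h.init_b] at e
    rw [e]
    fin_cases j <;> fin_cases k <;> simp
  let F : Matrix (Fin 3) (Fin 3) ℝ := Matrix.of ![m s, n s, b s]
  have h1 : F.transpose * F = 1 := by
    ext j k
    rw [← e j k]
    simp [F, Matrix.mul_apply, Fin.sum_univ_three]
  have h2 : F * F.transpose = 1 := mul_eq_one_comm.1 h1
  have h3 := congrFun (congrFun h2 0) 0
  rw [EuclideanSpace.norm_eq, Real.sqrt_eq_one]
  simp [F, Matrix.mul_apply, Fin.sum_univ_three] at h3
  simp [Fin.sum_univ_three, sq, h3]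

/-- Continuous dependence of the components on the parameter. -/
lemma continuousOn_component {c₀ : ℝ} (hc₀ : 0 ≤ c₀) {m n b : ℝ → ℝ → E3}
    (h : ∀ α ∈ Icc (0 : ℝ) 1, IsFrenetSolution c₀ α (m α) (n α) (b α)) (j : Fin 3) {s : ℝ}
    (hs : 0 ≤ s) :
    ContinuousOn (fun α => m α s j) (Icc 0 1) ∧ ContinuousOn (fun α => n α s j) (Icc 0 1) ∧
      ContinuousOn (fun α => b α s j) (Icc 0 1) := by
  -- The bound `2 * K * s` of `dist_sq_le`, with `K` estimating the differences of curvature and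
  -- torsion over [0, s].
  let κ : ℝ → ℝ → ℝ := fun α₀ α => 2 * (c₀ * (|α - α₀| * s ^ 2 / 4) + |beta α - beta α₀| * s / 2) * s
  have hκ : ∀ α₀, Tendsto (fun α => Real.sqrt (κ α₀ α)) (𝓝[Icc 0 1] α₀) (𝓝 0) := by
    intro α₀
    have : Continuous fun α => Real.sqrt (κ α₀ α) := by
      have := continuous_beta
      fun_prop
    refine (this.tendsto' α₀ 0 ?_).mono_left nhdsWithin_le_nhds
    simp [κ]
  have key : ∀ α₀ ∈ Icc (0 : ℝ) 1, ∀ α ∈ Icc (0 : ℝ) 1,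
      (m α s j - m α₀ s j) ^ 2 + (n α s j - n α₀ s j) ^ 2 + (b α s j - b α₀ s j) ^ 2 ≤ κ α₀ α := by
    intro α₀ h₀ α h₁
    refine ((h α h₁).component j).dist_sq_le ((h α₀ h₀).component j) ((h α h₁).unit_component j)
      ((h α₀ h₀).unit_component j) ?_ ?_ ?_ hs ?_
    · simp [(h α h₁).init_m, (h α₀ h₀).init_m]
    · simp [(h α h₁).init_n, (h α₀ h₀).init_n]
    · simp [(h α h₁).init_b, (h α₀ h₀).init_b]
    · intro u hu
      have hu2 : u ^ 2 ≤ s ^ 2 := pow_le_pow_left₀ hu.1 hu.2 2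
      refine add_le_add ?_ ?_
      · rw [curvature, curvature, ← mul_sub, abs_mul, abs_of_nonneg hc₀]
        refine mul_le_mul_of_nonneg_left ?_ hc₀
        rw [neg_div, neg_div]
        refine (exp_neg_sub_le (by have := h₁.1; positivity) (by have := h₀.1; positivity)).trans ?_
        rw [← sub_div, ← sub_mul, abs_div, abs_mul, abs_of_nonneg (sq_nonneg u),
          abs_of_pos (by norm_num : (0 : ℝ) < 4)]
        gcongr
      · rw [torsion, torsion, ← sub_div, ← sub_mul, abs_div, abs_mul, abs_of_nonneg hu.1,
          abs_of_pos (by norm_num : (0 : ℝ) < 2)]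
        have := hu.2
        gcongr
  refine ⟨fun α₀ h₀ => ?_, fun α₀ h₀ => ?_, fun α₀ h₀ => ?_⟩ <;>
  · refine tendsto_iff_norm_sub_tendsto_zero.2 (squeeze_zero' (.of_forall fun _ => norm_nonneg _) ?_
      (hκ α₀))
    filter_upwards [self_mem_nhdsWithin] with α h₁
    refine Real.le_sqrt_of_sq_le ?_
    rw [Real.norm_eq_abs, sq_abs]
    nlinarith [key α₀ h₀ α h₁, sq_nonneg (m α s j - m α₀ s j), sq_nonneg (n α s j - n α₀ s j),
      sq_nonneg (b α s j - b α₀ s j)]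

/-! ### Limits with a rate, and the comparison functions K c s^{-k}. -/

/-- A function whose derivative is dominated by that of a decreasing null function converges,
with that function as rate. -/
lemma exists_limit_of_norm_deriv_le {E : Type*} [NormedAddCommGroup E] [NormedSpace ℝ E]
    [CompleteSpace E] {f f' : ℝ → E} {H H' : ℝ → ℝ} {s₀ : ℝ}
    (hf : ∀ s, s₀ ≤ s → HasDerivAt f (f' s) s) (hH : ∀ s, s₀ ≤ s → HasDerivAt H (-H' s) s)
    (hle : ∀ s, s₀ ≤ s → ‖f' s‖ ≤ H' s) (hlim : Tendsto H atTop (𝓝 0)) :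
    ∃ L, Tendsto f atTop (𝓝 L) ∧ ∀ s, s₀ ≤ s → ‖f s - L‖ ≤ H s := by
  have key : ∀ s, s₀ ≤ s → ∀ u, s ≤ u → ‖f u - f s‖ ≤ H s - H u := by
    intro s hs u hu
    refine image_norm_le_of_norm_deriv_right_le_deriv_boundary' (a := s) (b := u)
      (f := fun v => f v - f s) (f' := f') (B := fun v => H s - H v) (B' := H')
      ?_ ?_ (by simp) ?_ ?_ ?_ (right_mem_Icc.2 hu)
    · exact fun v hv => ((hf v (hs.trans hv.1)).sub_const _).continuousAt.continuousWithinAt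
    · exact fun v hv => ((hf v (hs.trans hv.1)).sub_const _).hasDerivWithinAt
    · intro v hv
      exact ((hH v (hs.trans hv.1)).const_sub (H s)).continuousAt.continuousWithinAt
    · intro v hv
      exact ((hH v (hs.trans hv.1)).const_sub (H s)).hasDerivWithinAt.congr_deriv (by ring)
    · exact fun v hv => hle v (hs.trans hv.1)
  have hlim' : ∀ s, Tendsto (fun u => H s - H u) atTop (𝓝 (H s)) := fun s => by
    simpa using hlim.const_sub (H s)
  have hnn : ∀ s, s₀ ≤ s → 0 ≤ H s := fun s hs =>
    ge_of_tendsto (hlim' s) ((eventually_ge_atTop s).mono fun u hu =>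
      (norm_nonneg _).trans (key s hs u hu))
  have hc : CauchySeq f := by
    rw [Metric.cauchySeq_iff']
    intro ε hε
    obtain ⟨N, hN, hN'⟩ := ((hlim.eventually (gt_mem_nhds hε)).and (eventually_ge_atTop s₀)).exists
    refine ⟨N, fun u hu => ?_⟩
    rw [dist_eq_norm]
    linarith [key N hN' u hu, hnn u (hN'.trans hu)]
  obtain ⟨L, hL⟩ := cauchySeq_tendsto_of_complete hc
  refine ⟨L, hL, fun s hs => ?_⟩
  rw [norm_sub_rev]
  exact le_of_tendsto_of_tendsto (hL.sub_const (f s)).norm (hlim' s)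
    ((eventually_ge_atTop s).mono fun u hu => key s hs u hu)

/-- Beyond the threshold s⁻¹ ≤ 1, so surplus powers of s⁻¹ can be dropped from the estimates. -/
lemma one_le_sZero (c₀ : ℝ) : 1 ≤ sZero c₀ := by
  have : 1 ≤ Real.sqrt (8 + c₀ ^ 2) := Real.one_le_sqrt.2 (by nlinarith [sq_nonneg c₀])
  unfold sZero; linarith

lemma hasDerivAt_curvature (c₀ α s : ℝ) :
    HasDerivAt (curvature c₀ α) (-(α * s / 2) * curvature c₀ α s) s := by
  unfold curvature
  have h : HasDerivAt (fun u : ℝ => -(α * u ^ 2) / 4) (-(α * s / 2)) s :=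
    ((((hasDerivAt_pow 2 s).const_mul α).neg).div_const 4).congr_deriv (by push_cast; ring)
  exact (h.exp.const_mul c₀).congr_deriv (by ring)

lemma hasDerivAt_inv' {s : ℝ} (hs : s ≠ 0) : HasDerivAt (fun u : ℝ => u⁻¹) (-(s⁻¹ ^ 2)) s :=
  (hasDerivAt_inv hs).congr_deriv (by rw [inv_pow])

lemma curvature_pos {c₀ : ℝ} (hc₀ : 0 < c₀) (α s : ℝ) : 0 < curvature c₀ α s := by
  unfold curvature; positivity

lemma curvature_le {c₀ α : ℝ} (hc₀ : 0 < c₀) (hα : 0 ≤ α) (s : ℝ) : curvature c₀ α s ≤ c₀ := by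
  unfold curvature
  refine mul_le_of_le_one_right hc₀.le (Real.exp_le_one_iff.2 ?_)
  have : 0 ≤ α * s ^ 2 := by positivity
  linarith

/-- The derivative of `c s⁻ᵏ`. -/
lemma hasDerivAt_curvature_mul_inv_pow (c₀ α K : ℝ) (k : ℕ) {s : ℝ} (hs : s ≠ 0) :
    HasDerivAt (fun u => K * (curvature c₀ α u * u⁻¹ ^ (k + 1)))
      (-(K * curvature c₀ α s * (α / 2 * s⁻¹ ^ k + (k + 1) * s⁻¹ ^ (k + 2)))) s := by
  refine (((hasDerivAt_curvature c₀ α s).mul ((hasDerivAt_inv' hs).pow (k + 1))).const_mul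
    K).congr_deriv ?_
  simp only [Pi.pow_apply]
  have hst : s * s⁻¹ = 1 := mul_inv_cancel₀ hs
  push_cast
  linear_combination (-(α / 2) * K * curvature c₀ α s * s⁻¹ ^ k) * hst

lemma tendsto_curvature_mul_inv_pow {c₀ α : ℝ} (hc₀ : 0 < c₀) (hα : 0 ≤ α) (K : ℝ) (k : ℕ) :
    Tendsto (fun u => K * (curvature c₀ α u * u⁻¹ ^ (k + 1))) atTop (𝓝 0) := by
  have h : Tendsto (fun u : ℝ => c₀ * u⁻¹ ^ (k + 1)) atTop (𝓝 0) := by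
    simpa using (tendsto_inv_atTop_zero.pow (k + 1)).const_mul c₀
  have h' := squeeze_zero' (f := fun u => curvature c₀ α u * u⁻¹ ^ (k + 1))
    ((eventually_ge_atTop 0).mono fun u hu => by
      have := curvature_pos hc₀ α u
      positivity)
    ((eventually_ge_atTop 0).mono fun u hu => by
      have := curvature_le hc₀ hα u
      gcongr) h
  simpa using h'.const_mul K

/-! ### Expansion of the tangent. -/

section tangent

variable {c₀ α : ℝ} {x y z : ℝ → ℝ}

/-- The combination `α n + β b`. -/
noncomputable def combX (α : ℝ) (y z : ℝ → ℝ) (s : ℝ) : ℝ := α * y s + beta α * z s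

/-- The combination `α b - β n`. -/
noncomputable def combY (α : ℝ) (y z : ℝ → ℝ) (s : ℝ) : ℝ := α * z s - beta α * y s

/-- The combination of tangent, normal and binormal whose derivative is integrable. -/
noncomputable def modTangent (c₀ α : ℝ) (x y z : ℝ → ℝ) (s : ℝ) : ℝ :=
  x s + 2 * curvature c₀ α s * combX α y z s * s⁻¹ - 2 * curvature c₀ α s ^ 2 * x s * s⁻¹ ^ 2
    - 4 * curvature c₀ α s * (α * combX α y z s + beta α * combY α y z s) * s⁻¹ ^ 3
    - 4 * curvature c₀ α s ^ 3 * combX α y z s * s⁻¹ ^ 3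

lemma IsScalarFrenet.hasDerivAt_combX (h : IsScalarFrenet c₀ α x y z) (s : ℝ) :
    HasDerivAt (combX α y z)
      (-(α * curvature c₀ α s * x s) + beta α * s / 2 * combY α y z s) s := by
  refine (((h.deriv_y s).const_mul α).add ((h.deriv_z s).const_mul (beta α))).congr_deriv ?_
  unfold torsion combY; ring

lemma IsScalarFrenet.hasDerivAt_combY (h : IsScalarFrenet c₀ α x y z) (s : ℝ) :
    HasDerivAt (combY α y z)
      (beta α * curvature c₀ α s * x s - beta α * s / 2 * combX α y z s) s := by
  refine (((h.deriv_z s).const_mul α).sub ((h.deriv_y s).const_mul (beta α))).congr_deriv ?_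
  unfold torsion combX; ring

/-- Write X = αn + βb and Y = αb - βn, so n = αX - βY and (cX)' = -(s/2) c n - α c² m. Hence m' = c
n is cancelled by the derivative of 2cX/s, up to -2cX/s² - 2αc²m/s. The term in c²m/s² removes the
part in αc²m/s. Since (c(αX + βY))' = -(s/2) c X + (β² - α²) c² m, the term in c(αX + βY)/s³ removes
cX/s², and the one in c³X/s³ removes the c³n/s² that has appeared. -/
lemma IsScalarFrenet.hasDerivAt_modTangent (h : IsScalarFrenet c₀ α x y z) (hα : α ∈ Icc (0 : ℝ) 1)
    {s : ℝ} (hs : s ≠ 0) :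
    HasDerivAt (modTangent c₀ α x y z)
      (12 * curvature c₀ α s * (α * combX α y z s + beta α * combY α y z s) * s⁻¹ ^ 4
        + 8 * α ^ 2 * curvature c₀ α s ^ 2 * x s * s⁻¹ ^ 3
        + 4 * α * curvature c₀ α s ^ 4 * x s * s⁻¹ ^ 3
        + 4 * α * curvature c₀ α s ^ 3 * combX α y z s * s⁻¹ ^ 2
        + 12 * curvature c₀ α s ^ 3 * combX α y z s * s⁻¹ ^ 4) s := by
  have hc := hasDerivAt_curvature c₀ α s
  have ht := hasDerivAt_inv' hs
  have hX := h.hasDerivAt_combX s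
  have hY := h.hasDerivAt_combY s
  refine ((((h.deriv_x s).add (((hc.const_mul 2).mul hX).mul ht)).sub
    ((((hc.pow 2).const_mul 2).mul (h.deriv_x s)).mul (ht.pow 2))).sub
    (((hc.const_mul 4).mul ((hX.const_mul α).add (hY.const_mul (beta α)))).mul (ht.pow 3))).sub
    ((((hc.pow 3).const_mul 4).mul hX).mul (ht.pow 3)) |>.congr_deriv ?_
  have hst : s * s⁻¹ = 1 := mul_inv_cancel₀ hs
  have hab := sq_add_beta_sq hα
  have hy : y s = α * combX α y z s - beta α * combY α y z s := by
    unfold combX combY; linear_combination (-y s) * hab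
  simp only [Pi.pow_apply, Pi.mul_apply, Pi.add_apply, hy]
  generalize curvature c₀ α s = c at *
  generalize combX α y z s = X at *
  generalize combY α y z s = Y at *
  generalize s⁻¹ = t at *
  generalize x s = m at *
  generalize beta α = β at *
  clear hy hY hX hc ht h
  push_cast
  grind

lemma abs_mul_le_of_abs_le_one {a b B : ℝ} (ha : 0 ≤ a) (hb : |b| ≤ 1) (h : a ≤ B) :
    |a * b| ≤ B := by
  rw [abs_mul, abs_of_nonneg ha]
  exact (mul_le_of_le_one_right ha hb).trans h

lemma combX_sq_add_combY_sq (hα : α ∈ Icc (0 : ℝ) 1) (y z : ℝ → ℝ) (s : ℝ) :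
    combX α y z s ^ 2 + combY α y z s ^ 2 = y s ^ 2 + z s ^ 2 := by
  unfold combX combY
  linear_combination (y s ^ 2 + z s ^ 2) * sq_add_beta_sq hα

lemma exists_tangent_limit (hc₀ : 0 < c₀) : ∃ K : ℝ, 0 ≤ K ∧
    ∀ α ∈ Icc (0 : ℝ) 1, ∀ x y z : ℝ → ℝ, IsScalarFrenet c₀ α x y z →
      (∀ s, x s ^ 2 + y s ^ 2 + z s ^ 2 = 1) →
      ∃ A, ∀ s, sZero c₀ ≤ s →
        |x s - A| ≤ K * (curvature c₀ α s * s⁻¹) ∧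
        |x s - (A - 2 * curvature c₀ α s * combX α y z s * s⁻¹
          + 2 * curvature c₀ α s ^ 2 * x s * s⁻¹ ^ 2)| ≤ K * (curvature c₀ α s * s⁻¹ ^ 3) := by
  -- Chosen so that 3K dominates 12 + 12c₀² and K/2 dominates 8c₀ + 4c₀³ + 4c₀², the coefficients of
  -- c s⁻⁴ and of α c s⁻² in the remainder.
  let K : ℝ := 16 * c₀ + 8 * c₀ ^ 3 + 8 * c₀ ^ 2 + 4 + 4 * c₀ ^ 2
  refine ⟨K + 6 + 2 * c₀ + 4 * c₀ ^ 2, by positivity, fun α hα x y z h hu => ?_⟩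
  have hab := sq_add_beta_sq hα
  have hx : ∀ s, |x s| ≤ 1 := fun s => by
    rw [← sq_le_one_iff_abs_le_one]; nlinarith [hu s, sq_nonneg (y s), sq_nonneg (z s)]
  have hXY : ∀ s, combX α y z s ^ 2 + combY α y z s ^ 2 ≤ 1 := fun s => by
    rw [combX_sq_add_combY_sq hα]; nlinarith [hu s, sq_nonneg (x s)]
  have hX : ∀ s, |combX α y z s| ≤ 1 := fun s => by
    rw [← sq_le_one_iff_abs_le_one]; nlinarith [hXY s, sq_nonneg (combY α y z s)]
  have hZ : ∀ s, |α * combX α y z s + beta α * combY α y z s| ≤ 1 := fun s => by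
    rw [← sq_le_one_iff_abs_le_one]
    nlinarith [hXY s, sq_nonneg (α * combY α y z s - beta α * combX α y z s)]
  have ht : ∀ s, sZero c₀ ≤ s → 0 < s⁻¹ ∧ s⁻¹ ≤ 1 := fun s hs => by
    have := (one_le_sZero c₀).trans hs
    exact ⟨by positivity, inv_le_one_of_one_le₀ this⟩
  have hne : ∀ s, sZero c₀ ≤ s → s ≠ 0 := fun s hs => by
    linarith [(one_le_sZero c₀).trans hs, (ht s hs).1] |> fun (h : 0 < s) => h.ne'
  have hα0 := hα.1
  have hα1 := hα.2
  have hbound : ∀ s, sZero c₀ ≤ s →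
      ‖12 * curvature c₀ α s * (α * combX α y z s + beta α * combY α y z s) * s⁻¹ ^ 4
        + 8 * α ^ 2 * curvature c₀ α s ^ 2 * x s * s⁻¹ ^ 3
        + 4 * α * curvature c₀ α s ^ 4 * x s * s⁻¹ ^ 3
        + 4 * α * curvature c₀ α s ^ 3 * combX α y z s * s⁻¹ ^ 2
        + 12 * curvature c₀ α s ^ 3 * combX α y z s * s⁻¹ ^ 4‖
      ≤ K * curvature c₀ α s * (α / 2 * s⁻¹ ^ 2 + (↑(2 : ℕ) + 1) * s⁻¹ ^ (2 + 2)) := by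
    intro s hs
    obtain ⟨ht0, ht1⟩ := ht s hs
    have hc := curvature_pos hc₀ α s
    have hc1 := curvature_le hc₀ hα.1 s
    have hXs := hX s
    have hZs := hZ s
    have hxs := hx s
    rw [Real.norm_eq_abs]
    generalize curvature c₀ α s = c at *
    generalize combX α y z s = X at *
    generalize combY α y z s = Y at *
    generalize s⁻¹ = t at *
    have e1 : |12 * c * t ^ 4 * (α * X + beta α * Y)| ≤ c * t ^ 4 * 12 :=
      abs_mul_le_of_abs_le_one (by positivity) hZs (by linarith)
    have e2 : |8 * α ^ 2 * c ^ 2 * t ^ 3 * x s| ≤ c * α * t ^ 2 * (8 * c₀) := by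
      refine abs_mul_le_of_abs_le_one (by positivity) hxs ?_
      calc 8 * α ^ 2 * c ^ 2 * t ^ 3 = c * α * t ^ 2 * (8 * (α * c * t)) := by ring
        _ ≤ c * α * t ^ 2 * (8 * (1 * c₀ * 1)) := by gcongr
        _ = _ := by ring
    have e3 : |4 * α * c ^ 4 * t ^ 3 * x s| ≤ c * α * t ^ 2 * (4 * c₀ ^ 3) := by
      refine abs_mul_le_of_abs_le_one (by positivity) hxs ?_
      calc 4 * α * c ^ 4 * t ^ 3 = c * α * t ^ 2 * (4 * (c ^ 3 * t)) := by ring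
        _ ≤ c * α * t ^ 2 * (4 * (c₀ ^ 3 * 1)) := by gcongr
        _ = _ := by ring
    have e4 : |4 * α * c ^ 3 * t ^ 2 * X| ≤ c * α * t ^ 2 * (4 * c₀ ^ 2) := by
      refine abs_mul_le_of_abs_le_one (by positivity) hXs ?_
      calc 4 * α * c ^ 3 * t ^ 2 = c * α * t ^ 2 * (4 * c ^ 2) := by ring
        _ ≤ c * α * t ^ 2 * (4 * c₀ ^ 2) := by gcongr
    have e5 : |12 * c ^ 3 * t ^ 4 * X| ≤ c * t ^ 4 * (12 * c₀ ^ 2) := by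
      refine abs_mul_le_of_abs_le_one (by positivity) hXs ?_
      calc 12 * c ^ 3 * t ^ 4 = c * t ^ 4 * (12 * c ^ 2) := by ring
        _ ≤ c * t ^ 4 * (12 * c₀ ^ 2) := by gcongr
    calc _ = |12 * c * t ^ 4 * (α * X + beta α * Y) + 8 * α ^ 2 * c ^ 2 * t ^ 3 * x s
          + 4 * α * c ^ 4 * t ^ 3 * x s + 4 * α * c ^ 3 * t ^ 2 * X
          + 12 * c ^ 3 * t ^ 4 * X| := by congr 1; ring
      _ ≤ c * t ^ 4 * 12 + c * α * t ^ 2 * (8 * c₀) + c * α * t ^ 2 * (4 * c₀ ^ 3)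
          + c * α * t ^ 2 * (4 * c₀ ^ 2) + c * t ^ 4 * (12 * c₀ ^ 2) := by
        refine (abs_add_le _ _).trans (add_le_add ?_ e5)
        refine (abs_add_le _ _).trans (add_le_add ?_ e4)
        refine (abs_add_le _ _).trans (add_le_add ?_ e3)
        exact (abs_add_le _ _).trans (add_le_add e1 e2)
      _ = c * t ^ 4 * (12 + 12 * c₀ ^ 2)
          + c * α * t ^ 2 * (8 * c₀ + 4 * c₀ ^ 3 + 4 * c₀ ^ 2) := by ring
      _ ≤ c * t ^ 4 * (3 * K) + c * α * t ^ 2 * (K / 2) := by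
        refine add_le_add (mul_le_mul_of_nonneg_left ?_ (by positivity))
          (mul_le_mul_of_nonneg_left ?_ (by positivity)) <;>
        · simp only [K]
          nlinarith [pow_pos hc₀ 2, pow_pos hc₀ 3]
      _ = _ := by push_cast; ring
  obtain ⟨A, -, hA'⟩ := exists_limit_of_norm_deriv_le
    (fun s hs => h.hasDerivAt_modTangent hα (hne s hs))
    (fun s hs => hasDerivAt_curvature_mul_inv_pow c₀ α K 2 (hne s hs)) hbound
    (tendsto_curvature_mul_inv_pow hc₀ hα.1 K 2)
  have hfar : ∀ s, sZero c₀ ≤ s →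
      |x s - (A - 2 * curvature c₀ α s * combX α y z s * s⁻¹
          + 2 * curvature c₀ α s ^ 2 * x s * s⁻¹ ^ 2)|
        ≤ (K + 4 + 4 * c₀ ^ 2) * (curvature c₀ α s * s⁻¹ ^ 3) := by
    intro s hs
    obtain ⟨ht0, ht1⟩ := ht s hs
    have hc := curvature_pos hc₀ α s
    have hc1 := curvature_le hc₀ hα.1 s
    have e0 := hA' s hs
    rw [Real.norm_eq_abs] at e0
    have e1 : |4 * curvature c₀ α s * s⁻¹ ^ 3 * (α * combX α y z s + beta α * combY α y z s)|
        ≤ curvature c₀ α s * s⁻¹ ^ 3 * 4 :=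
      abs_mul_le_of_abs_le_one (by positivity) (hZ s) (by linarith)
    have e2 : |4 * curvature c₀ α s ^ 3 * s⁻¹ ^ 3 * combX α y z s|
        ≤ curvature c₀ α s * s⁻¹ ^ 3 * (4 * c₀ ^ 2) := by
      refine abs_mul_le_of_abs_le_one (by positivity) (hX s) ?_
      calc _ = curvature c₀ α s * s⁻¹ ^ 3 * (4 * curvature c₀ α s ^ 2) := by ring
        _ ≤ _ := by gcongr
    have e3 : x s - (A - 2 * curvature c₀ α s * combX α y z s * s⁻¹
          + 2 * curvature c₀ α s ^ 2 * x s * s⁻¹ ^ 2) = (modTangent c₀ α x y z s - A)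
        + 4 * curvature c₀ α s * s⁻¹ ^ 3 * (α * combX α y z s + beta α * combY α y z s)
        + 4 * curvature c₀ α s ^ 3 * s⁻¹ ^ 3 * combX α y z s := by
      unfold modTangent; ring
    rw [e3]
    refine (abs_add_le _ _).trans ((add_le_add ((abs_add_le _ _).trans (add_le_add e0 e1)) e2).trans
      (le_of_eq ?_))
    ring
  -- The cruder rate c/s follows by treating the explicit corrections as errors as well.
  have hnear : ∀ s, sZero c₀ ≤ s →
      |x s - A| ≤ (K + 6 + 2 * c₀ + 4 * c₀ ^ 2) * (curvature c₀ α s * s⁻¹) := by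
    intro s hs
    obtain ⟨ht0, ht1⟩ := ht s hs
    have hc := curvature_pos hc₀ α s
    have hc1 := curvature_le hc₀ hα.1 s
    have hK : 0 ≤ K := by positivity
    have e0 : (K + 4 + 4 * c₀ ^ 2) * (curvature c₀ α s * s⁻¹ ^ 3)
        ≤ (K + 4 + 4 * c₀ ^ 2) * (curvature c₀ α s * s⁻¹) := by
      gcongr
      exact pow_le_of_le_one ht0.le ht1 (by norm_num)
    have e1 : |2 * curvature c₀ α s * s⁻¹ * combX α y z s| ≤ curvature c₀ α s * s⁻¹ * 2 :=
      abs_mul_le_of_abs_le_one (by positivity) (hX s) (by linarith)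
    have e2 : |2 * curvature c₀ α s ^ 2 * s⁻¹ ^ 2 * x s|
        ≤ curvature c₀ α s * s⁻¹ * (2 * c₀) := by
      refine abs_mul_le_of_abs_le_one (by positivity) (hx s) ?_
      calc _ = curvature c₀ α s * s⁻¹ * (2 * (curvature c₀ α s * s⁻¹)) := by ring
        _ ≤ curvature c₀ α s * s⁻¹ * (2 * (c₀ * 1)) := by gcongr
        _ = _ := by ring
    have e3 : x s - A = (x s - (A - 2 * curvature c₀ α s * combX α y z s * s⁻¹
          + 2 * curvature c₀ α s ^ 2 * x s * s⁻¹ ^ 2))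
        - 2 * curvature c₀ α s * s⁻¹ * combX α y z s
        + 2 * curvature c₀ α s ^ 2 * s⁻¹ ^ 2 * x s := by ring
    rw [e3]
    refine (abs_add_le _ _).trans ((add_le_add ((abs_sub _ _).trans
      (add_le_add ((hfar s hs).trans e0) e1)) e2).trans (le_of_eq ?_))
    ring
  refine ⟨A, fun s hs => ⟨hnear s hs, (hfar s hs).trans ?_⟩⟩
  have := curvature_pos hc₀ α s
  have := (ht s hs).1
  exact mul_le_mul_of_nonneg_right (by linarith) (by positivity)

end tangent

/-! ### Derivative and expansion of the phase. -/

section phase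

variable {c₀ α : ℝ}

/-- The derivative of the phase. -/
noncomputable def phaseSpeed (c₀ α s : ℝ) : ℝ :=
  beta α * s / 2 * Real.sqrt (1 + 4 * curvature c₀ α s ^ 2 * s⁻¹ ^ 2)

lemma phase_eq_add (c₀ α a s : ℝ) : phase c₀ α a s = a + phase c₀ α 0 s := by
  simp [phase]

lemma hasDerivAt_phase (c₀ α a : ℝ) {s : ℝ} (hs : sZero c₀ ≤ s) :
    HasDerivAt (phase c₀ α a) (phaseSpeed c₀ α s) s := by
  have h0 := one_le_sZero c₀
  have hs0 : 0 < s := by linarith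
  let f : ℝ → ℝ := fun σ => Real.sqrt (1 + c₀ ^ 2 * (Real.exp (-(2 * α * σ)) / σ))
  have hcont : ∀ σ : ℝ, 0 < σ → ContinuousAt f σ := fun σ hσ => by
    have := hσ.ne'
    fun_prop (disch := assumption)
  have hF : HasDerivAt (fun u => ∫ σ in ((sZero c₀) ^ 2 / 4)..u, f σ) (f (s ^ 2 / 4)) (s ^ 2 / 4) := by
    refine intervalIntegral.integral_hasDerivAt_right ?_ ?_ (hcont _ (by positivity))
    · refine ContinuousOn.intervalIntegrable fun σ hσ => (hcont σ ?_).continuousWithinAt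
      exact lt_of_lt_of_le (lt_min (by positivity) (by positivity)) hσ.1
    · exact ContinuousOn.stronglyMeasurableAtFilter isOpen_Ioi
        (fun σ hσ => (hcont σ hσ).continuousWithinAt) _ (by positivity : (0 : ℝ) < s ^ 2 / 4)
  have hq : HasDerivAt (fun u : ℝ => u ^ 2 / 4) (s / 2) s :=
    ((hasDerivAt_pow 2 s).div_const 4).congr_deriv (by push_cast; ring)
  refine (((hF.comp s hq).const_mul (beta α)).const_add a).congr_deriv ?_
  -- At σ = s²/4 the exponential in the integrand is (c/c₀)².
  have e : 1 + c₀ ^ 2 * (Real.exp (-(2 * α * (s ^ 2 / 4))) / (s ^ 2 / 4))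
      = 1 + 4 * curvature c₀ α s ^ 2 * s⁻¹ ^ 2 := by
    rw [curvature, mul_pow, ← Real.exp_nat_mul]
    have : -(2 * α * (s ^ 2 / 4)) = ((2 : ℕ) : ℝ) * (-(α * s ^ 2) / 4) := by push_cast; ring
    rw [this]
    field_simp
  simp only [f, e, phaseSpeed]
  ring

/-- This is √(1 + 4X) = 1 + 2X + O(X²) with X = c²/s². The second bound keeps the factor of c²/s at
most 1 in modulus without any smallness of X. -/
lemma exists_phaseSpeed_eq (hc₀ : 0 < c₀) {s : ℝ} (hs : 0 < s) :
    ∃ ρ : ℝ, |ρ| ≤ 1 ∧ |beta α + curvature c₀ α s ^ 2 * s⁻¹ ^ 2 * ρ| ≤ 1 ∧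
      phaseSpeed c₀ α s = beta α * s / 2 + curvature c₀ α s ^ 2 * s⁻¹ *
        (beta α + curvature c₀ α s ^ 2 * s⁻¹ ^ 2 * ρ) := by
  have hc := curvature_pos hc₀ α s
  have hb := beta_nonneg α
  have hb1 := beta_le_one α
  have ht : 0 < s⁻¹ := inv_pos.2 hs
  have hst : s * s⁻¹ = 1 := mul_inv_cancel₀ hs.ne'
  unfold phaseSpeed
  generalize curvature c₀ α s = c at *
  generalize s⁻¹ = t at *
  set X := c ^ 2 * t ^ 2 with hX
  have hXp : 0 < X := by positivity
  set S := Real.sqrt (1 + 4 * c ^ 2 * t ^ 2) with hS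
  have hS2 : S ^ 2 = 1 + 4 * X := by
    rw [hS, Real.sq_sqrt (by positivity), hX]; ring
  have hS0 : 0 ≤ S := Real.sqrt_nonneg _
  have hS1 : 1 ≤ S := by nlinarith
  have hS3 : S ≤ 1 + 2 * X := by nlinarith
  -- Here 1 + 2X - S = (S - 1)²/2, and S - 1 ≤ 2X.
  have hS4 : 1 + 2 * X - 2 * X ^ 2 ≤ S := by nlinarith [sq_nonneg (S - 1)]
  refine ⟨beta α * (S - 1 - 2 * X) / (2 * X ^ 2), ?_, ?_, ?_⟩
  · rw [abs_div, abs_of_pos (by positivity : 0 < 2 * X ^ 2), div_le_one (by positivity), abs_mul,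
      abs_of_nonneg hb]
    refine (mul_le_of_le_one_left (abs_nonneg _) hb1).trans ?_
    rw [abs_le]; constructor <;> nlinarith [sq_nonneg X]
  · have : beta α + X * (beta α * (S - 1 - 2 * X) / (2 * X ^ 2)) = beta α * ((S - 1) / (2 * X)) := by
      field_simp; ring
    rw [this, abs_mul, abs_of_nonneg hb, abs_of_nonneg (by
      have : 0 ≤ S - 1 := by linarith
      positivity)]
    refine mul_le_one₀ hb1 (div_nonneg (by linarith) (by positivity)) ?_
    rw [div_le_one (by positivity)]; linarith
  · have e : beta α + X * (beta α * (S - 1 - 2 * X) / (2 * X ^ 2)) = beta α * ((S - 1) / (2 * X)) := by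
      field_simp; ring
    have e2 : c ^ 2 * t = X * s := by rw [hX]; linear_combination (-c ^ 2 * t) * hst
    rw [e, e2]
    field_simp
    ring

end phase

/-! ### Expansion of normal and binormal in complex form. -/

section normal

variable {c₀ α : ℝ} {x y z : ℝ → ℝ}

open Complex

/-- The unit complex number `-α + iβ`. -/
noncomputable def rot (α : ℝ) : ℂ := -(α : ℂ) + beta α * I

lemma norm_rot (hα : α ∈ Icc (0 : ℝ) 1) : ‖rot α‖ = 1 := by
  have : ‖rot α‖ ^ 2 = 1 := by
    rw [← normSq_eq_norm_sq, normSq_apply, rot]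
    simp
    linarith [sq_add_beta_sq hα]
  nlinarith [norm_nonneg (rot α)]

/-- The normal and binormal combined and corrected by lower order terms; up to an integrable
error it rotates with the speed of the phase. -/
noncomputable def modNormal (c₀ α : ℝ) (x y z : ℝ → ℝ) (s : ℝ) : ℂ :=
  (z s + y s * I) + 2 * I * rot α * curvature c₀ α s * x s * (s⁻¹ : ℝ)
    + rot α ^ 2 * curvature c₀ α s ^ 2 * (z s - y s * I) * (s⁻¹ : ℝ) ^ 2
    + 4 * I * rot α ^ 2 * curvature c₀ α s * x s * (s⁻¹ : ℝ) ^ 3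
    - 2 * I * rot α * (rot α ^ 2 - 2 * beta α * I * rot α) * curvature c₀ α s ^ 3 * x s
      * (s⁻¹ : ℝ) ^ 3

/-- Let w = b + i n and λ = `rot α`, so that λ⁻¹ is the conjugate of λ. In the rotating frame, c has
leading logarithmic derivative (s/2)λ⁻¹, so 2iλcm/s cancels the forcing -icm. It leaves 2iλc²n/s =
λc²(w - w̄)/s. The w part splits into the rotation iβc²/s, which the phase takes up, and -αc²/s,
which is admissible. The w̄ part oscillates and is cancelled by λ²c²w̄/s². The two corrections of
order s⁻³ remove the remaining terms in cm/s² and c³m/s². -/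
lemma IsScalarFrenet.hasDerivAt_modNormal (h : IsScalarFrenet c₀ α x y z)
    (hα : α ∈ Icc (0 : ℝ) 1) {s ρ δ : ℝ} (hs : s ≠ 0)
    (hδ : δ = beta α + curvature c₀ α s ^ 2 * s⁻¹ ^ 2 * ρ) :
    HasDerivAt (modNormal c₀ α x y z)
      (I * ((beta α * s / 2 + curvature c₀ α s ^ 2 * s⁻¹ * δ : ℝ) : ℂ) * modNormal c₀ α x y z s
        + (((curvature c₀ α s ^ 4 * s⁻¹ ^ 3 : ℝ) : ℂ) * (-I * ρ * (z s + y s * I))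
          + ((curvature c₀ α s ^ 5 * s⁻¹ ^ 4 : ℝ) : ℂ) * (2 * (rot α * (ρ * x s)))
          + ((α * curvature c₀ α s ^ 2 * s⁻¹ : ℝ) : ℂ) * (-(z s + y s * I))
          + ((curvature c₀ α s ^ 2 * s⁻¹ ^ 3 : ℝ) : ℂ) * (-2 * (rot α ^ 2 * (z s - y s * I)))
          + ((curvature c₀ α s ^ 4 * s⁻¹ ^ 3 : ℝ) : ℂ) * (-I * δ * (rot α ^ 2 * (z s - y s * I)))
          + ((curvature c₀ α s * s⁻¹ ^ 4 : ℝ) : ℂ) * (-12 * (I * (rot α ^ 2 * x s)))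
          + ((curvature c₀ α s ^ 2 * s⁻¹ ^ 3 : ℝ) : ℂ) * (4 * (I * (rot α ^ 2 * y s)))
          + ((curvature c₀ α s ^ 3 * s⁻¹ ^ 4 : ℝ) : ℂ) * (4 * (rot α ^ 2 * (δ * x s)))
          + (-2 * I * rot α * (rot α ^ 2 - 2 * beta α * I * rot α)) *
            (((α * curvature c₀ α s ^ 3 * s⁻¹ ^ 2 : ℝ) : ℂ) * (-x s)
              + ((curvature c₀ α s ^ 3 * s⁻¹ ^ 4 : ℝ) : ℂ) * (-3 * x s)
              + ((curvature c₀ α s ^ 4 * s⁻¹ ^ 3 : ℝ) : ℂ) * y s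
              + ((curvature c₀ α s ^ 5 * s⁻¹ ^ 4 : ℝ) : ℂ) * (-I * (δ * x s))))) s := by
  have hc := (hasDerivAt_curvature c₀ α s).ofReal_comp
  have ht := (hasDerivAt_inv' hs).ofReal_comp
  have hx := (h.deriv_x s).ofReal_comp
  have hy := (h.deriv_y s).ofReal_comp
  have hz := (h.deriv_z s).ofReal_comp
  refine (((((hz.add (hy.mul_const I)).add (((hc.const_mul (2 * I * rot α)).mul hx).mul ht)).add
    ((((hc.pow 2).const_mul (rot α ^ 2)).mul (hz.sub (hy.mul_const I))).mul (ht.pow 2))).add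
    (((hc.const_mul (4 * I * rot α ^ 2)).mul hx).mul (ht.pow 3))).sub
    ((((hc.pow 3).const_mul (2 * I * rot α * (rot α ^ 2 - 2 * beta α * I * rot α))).mul hx).mul
      (ht.pow 3))).congr_deriv ?_
  have hst : (s : ℂ) * ((s⁻¹ : ℝ) : ℂ) = 1 := by
    rw [← ofReal_mul, mul_inv_cancel₀ hs, ofReal_one]
  have hab : (α : ℂ) ^ 2 + (beta α : ℂ) ^ 2 = 1 := by exact_mod_cast sq_add_beta_sq hα
  have hI : I ^ 2 = -1 := I_sq
  simp only [Pi.pow_apply, Pi.mul_apply, Pi.sub_apply, modNormal, torsion, hδ]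
  push_cast
  rw [← ofReal_inv]
  clear hx hy hz hc ht h hδ
  unfold rot
  generalize (curvature c₀ α s : ℂ) = c at *
  generalize ((s⁻¹ : ℝ) : ℂ) = t at *
  generalize (x s : ℂ) = m at *
  generalize (y s : ℂ) = n at *
  generalize (z s : ℂ) = b at *
  generalize (beta α : ℂ) = β at *
  generalize (α : ℂ) = a at *
  generalize (s : ℂ) = u at *
  generalize (ρ : ℂ) = r at *
  generalize I = i at *
  grind

end normal

section normal

variable {c₀ α : ℝ} {x y z : ℝ → ℝ}

open Complex

lemma norm_ofReal_mul_le {a M B : ℝ} {u : ℂ} (ha : 0 ≤ a) (hu : ‖u‖ ≤ M) (h : a * M ≤ B) :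
    ‖(a : ℂ) * u‖ ≤ B := by
  rw [norm_mul, norm_real, Real.norm_of_nonneg ha]
  exact (mul_le_mul_of_nonneg_left hu ha).trans h

lemma norm_add_mul_I_le {a b : ℝ} (h : a ^ 2 + b ^ 2 ≤ 1) : ‖(a + b * I : ℂ)‖ ≤ 1 := by
  rw [Complex.norm_add_mul_I]
  exact Real.sqrt_le_one.2 h

/-- A bound for the error in the equation of the corrected normal vector. -/
lemma norm_modNormal_error_le {c₀ c t β ρ δ m n b : ℝ} {l : ℂ} (hc : 0 < c) (hc₁ : c ≤ c₀)
    (hα : 0 ≤ α) (ht : 0 < t) (ht₁ : t ≤ 1) (hβ : 0 ≤ β) (hβ₁ : β ≤ 1) (hρ : |ρ| ≤ 1)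
    (hδ : |δ| ≤ 1) (hu : m ^ 2 + n ^ 2 + b ^ 2 = 1) (hl : ‖l‖ = 1) :
    ‖((c ^ 4 * t ^ 3 : ℝ) : ℂ) * (-I * ρ * (b + n * I))
          + ((c ^ 5 * t ^ 4 : ℝ) : ℂ) * (2 * (l * (ρ * m)))
          + ((α * c ^ 2 * t : ℝ) : ℂ) * (-(b + n * I))
          + ((c ^ 2 * t ^ 3 : ℝ) : ℂ) * (-2 * (l ^ 2 * (b - n * I)))
          + ((c ^ 4 * t ^ 3 : ℝ) : ℂ) * (-I * δ * (l ^ 2 * (b - n * I)))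
          + ((c * t ^ 4 : ℝ) : ℂ) * (-12 * (I * (l ^ 2 * m)))
          + ((c ^ 2 * t ^ 3 : ℝ) : ℂ) * (4 * (I * (l ^ 2 * n)))
          + ((c ^ 3 * t ^ 4 : ℝ) : ℂ) * (4 * (l ^ 2 * (δ * m)))
          + (-2 * I * l * (l ^ 2 - 2 * β * I * l)) *
            (((α * c ^ 3 * t ^ 2 : ℝ) : ℂ) * (-m)
              + ((c ^ 3 * t ^ 4 : ℝ) : ℂ) * (-3 * m)
              + ((c ^ 4 * t ^ 3 : ℝ) : ℂ) * n
              + ((c ^ 5 * t ^ 4 : ℝ) : ℂ) * (-I * (δ * m)))‖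
      ≤ (12 + 6 * c₀ + 22 * c₀ ^ 2 + 8 * c₀ ^ 3 + 8 * c₀ ^ 4) * (c * t ^ 3)
        + (c₀ + 6 * c₀ ^ 2) * (α * c * t) := by
  have hc0 : 0 < c₀ := hc.trans_le hc₁
  have hm : |m| ≤ 1 := by
    rw [← sq_le_one_iff_abs_le_one]; nlinarith [sq_nonneg n, sq_nonneg b]
  have hn : |n| ≤ 1 := by
    rw [← sq_le_one_iff_abs_le_one]; nlinarith [sq_nonneg m, sq_nonneg b]
  have hw : ‖(b + n * I : ℂ)‖ ≤ 1 := norm_add_mul_I_le (by nlinarith [sq_nonneg m])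
  have hw' : ‖(b - n * I : ℂ)‖ ≤ 1 := by
    have := norm_add_mul_I_le (a := b) (b := -n) (by nlinarith [sq_nonneg m])
    simpa [sub_eq_add_neg] using this
  have hδm : |δ| * |m| ≤ 1 := mul_le_one₀ hδ (abs_nonneg _) hm
  have hρm : |ρ| * |m| ≤ 1 := mul_le_one₀ hρ (abs_nonneg _) hm
  -- Surplus factors c and s⁻¹ are replaced by c₀ and 1, which reduces every term without α to c
  -- s⁻³.
  have mono : ∀ k l : ℕ, c ^ (k + 1) * t ^ (l + 3) ≤ c₀ ^ k * (c * t ^ 3) := fun k l => by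
    calc c ^ (k + 1) * t ^ (l + 3) = c ^ k * t ^ l * (c * t ^ 3) := by ring
      _ ≤ c₀ ^ k * 1 * (c * t ^ 3) := by
        gcongr
        exact pow_le_one₀ ht.le ht₁
      _ = _ := by ring
  have m01 : c * t ^ 4 ≤ c * t ^ 3 := by simpa using mono 0 1
  have m10 : c ^ 2 * t ^ 3 ≤ c₀ * (c * t ^ 3) := by simpa using mono 1 0
  have m21 : c ^ 3 * t ^ 4 ≤ c₀ ^ 2 * (c * t ^ 3) := mono 2 1
  have m30 : c ^ 4 * t ^ 3 ≤ c₀ ^ 3 * (c * t ^ 3) := mono 3 0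
  have m41 : c ^ 5 * t ^ 4 ≤ c₀ ^ 4 * (c * t ^ 3) := mono 4 1
  have hL : ‖-2 * I * l * (l ^ 2 - 2 * β * I * l)‖ ≤ 6 := by
    have : ‖l ^ 2 - 2 * β * I * l‖ ≤ 3 := by
      refine (norm_sub_le _ _).trans ?_
      simp only [norm_mul, norm_pow, hl, norm_I, norm_real, Real.norm_eq_abs, abs_of_nonneg hβ,
        RCLike.norm_ofNat]
      linarith
    simp only [norm_mul, norm_neg, hl, norm_I, RCLike.norm_ofNat] at this ⊢
    linarith
  have e1 : ‖((c ^ 4 * t ^ 3 : ℝ) : ℂ) * (-I * ρ * (b + n * I))‖ ≤ c₀ ^ 3 * (c * t ^ 3) := by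
    refine norm_ofReal_mul_le (M := 1) (by positivity) ?_ (by linarith [m30])
    simp only [norm_mul, norm_neg, norm_I, norm_real, Real.norm_eq_abs, one_mul]
    exact mul_le_one₀ hρ (norm_nonneg _) hw
  have e2 : ‖((c ^ 5 * t ^ 4 : ℝ) : ℂ) * (2 * (l * (ρ * m)))‖ ≤ 2 * c₀ ^ 4 * (c * t ^ 3) := by
    refine norm_ofReal_mul_le (M := 2) (by positivity) ?_ (by linarith [m41])
    simp only [norm_mul, hl, norm_real, Real.norm_eq_abs, one_mul, RCLike.norm_ofNat]
    linarith
  have e3 : ‖((α * c ^ 2 * t : ℝ) : ℂ) * (-(b + n * I))‖ ≤ c₀ * (α * c * t) := by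
    refine norm_ofReal_mul_le (M := 1) (by positivity) (by rwa [norm_neg]) ?_
    calc α * c ^ 2 * t * 1 = c * (α * c * t) := by ring
      _ ≤ _ := by gcongr
  have e4 : ‖((c ^ 2 * t ^ 3 : ℝ) : ℂ) * (-2 * (l ^ 2 * (b - n * I)))‖
      ≤ 2 * c₀ * (c * t ^ 3) := by
    refine norm_ofReal_mul_le (M := 2) (by positivity) ?_ (by linarith [m10])
    simp only [norm_mul, norm_neg, norm_pow, hl, one_pow, one_mul, RCLike.norm_ofNat]
    linarith
  have e5 : ‖((c ^ 4 * t ^ 3 : ℝ) : ℂ) * (-I * δ * (l ^ 2 * (b - n * I)))‖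
      ≤ c₀ ^ 3 * (c * t ^ 3) := by
    refine norm_ofReal_mul_le (M := 1) (by positivity) ?_ (by linarith [m30])
    simp only [norm_mul, norm_neg, norm_pow, hl, norm_I, norm_real, Real.norm_eq_abs, one_pow,
      one_mul]
    exact mul_le_one₀ hδ (norm_nonneg _) hw'
  have e6 : ‖((c * t ^ 4 : ℝ) : ℂ) * (-12 * (I * (l ^ 2 * m)))‖ ≤ 12 * (c * t ^ 3) := by
    refine norm_ofReal_mul_le (M := 12) (by positivity) ?_ (by linarith [m01])
    simp only [norm_mul, norm_neg, norm_pow, hl, norm_I, norm_real, Real.norm_eq_abs, one_pow,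
      one_mul, RCLike.norm_ofNat]
    linarith
  have e7 : ‖((c ^ 2 * t ^ 3 : ℝ) : ℂ) * (4 * (I * (l ^ 2 * n)))‖ ≤ 4 * c₀ * (c * t ^ 3) := by
    refine norm_ofReal_mul_le (M := 4) (by positivity) ?_ (by linarith [m10])
    simp only [norm_mul, norm_pow, hl, norm_I, norm_real, Real.norm_eq_abs, one_pow,
      one_mul, RCLike.norm_ofNat]
    linarith
  have e8 : ‖((c ^ 3 * t ^ 4 : ℝ) : ℂ) * (4 * (l ^ 2 * (δ * m)))‖
      ≤ 4 * c₀ ^ 2 * (c * t ^ 3) := by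
    refine norm_ofReal_mul_le (M := 4) (by positivity) ?_ (by linarith [m21])
    simp only [norm_mul, norm_pow, hl, norm_real, Real.norm_eq_abs, one_pow,
      one_mul, RCLike.norm_ofNat]
    linarith
  have f1 : ‖((α * c ^ 3 * t ^ 2 : ℝ) : ℂ) * (-m)‖ ≤ c₀ ^ 2 * (α * c * t) := by
    refine norm_ofReal_mul_le (M := 1) (by positivity) (by simpa using hm) ?_
    calc α * c ^ 3 * t ^ 2 * 1 = c ^ 2 * t * (α * c * t) := by ring
      _ ≤ c₀ ^ 2 * 1 * (α * c * t) := by gcongr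
      _ = _ := by ring
  have f2 : ‖((c ^ 3 * t ^ 4 : ℝ) : ℂ) * (-3 * m)‖ ≤ 3 * c₀ ^ 2 * (c * t ^ 3) := by
    refine norm_ofReal_mul_le (M := 3) (by positivity) ?_ (by linarith [m21])
    simp only [norm_mul, norm_neg, norm_real, Real.norm_eq_abs, RCLike.norm_ofNat]
    linarith
  have f3 : ‖((c ^ 4 * t ^ 3 : ℝ) : ℂ) * n‖ ≤ c₀ ^ 3 * (c * t ^ 3) :=
    norm_ofReal_mul_le (M := 1) (by positivity) (by simpa using hn) (by linarith [m30])
  have f4 : ‖((c ^ 5 * t ^ 4 : ℝ) : ℂ) * (-I * (δ * m))‖ ≤ c₀ ^ 4 * (c * t ^ 3) := by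
    refine norm_ofReal_mul_le (M := 1) (by positivity) ?_ (by linarith [m41])
    simpa only [norm_mul, norm_neg, norm_I, norm_real, Real.norm_eq_abs, one_mul] using hδm
  have e9 : ‖(-2 * I * l * (l ^ 2 - 2 * β * I * l)) *
            (((α * c ^ 3 * t ^ 2 : ℝ) : ℂ) * (-m)
              + ((c ^ 3 * t ^ 4 : ℝ) : ℂ) * (-3 * m)
              + ((c ^ 4 * t ^ 3 : ℝ) : ℂ) * n
              + ((c ^ 5 * t ^ 4 : ℝ) : ℂ) * (-I * (δ * m)))‖
      ≤ 6 * (c₀ ^ 2 * (α * c * t) + 3 * c₀ ^ 2 * (c * t ^ 3) + c₀ ^ 3 * (c * t ^ 3)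
        + c₀ ^ 4 * (c * t ^ 3)) := by
    rw [norm_mul]
    exact mul_le_mul hL (norm_add_le_of_le (norm_add_le_of_le (norm_add_le_of_le f1 f2) f3) f4)
      (norm_nonneg _) (by norm_num)
  refine (norm_add_le_of_le (norm_add_le_of_le (norm_add_le_of_le (norm_add_le_of_le
    (norm_add_le_of_le (norm_add_le_of_le (norm_add_le_of_le (norm_add_le_of_le
    e1 e2) e3) e4) e5) e6) e7) e8) e9).trans (le_of_eq ?_)
  ring

/-- The factor e^{-iφ} removes the rotation exactly and has modulus 1, so the remaining error is
dominated by the derivative of K c s⁻². The correction of order c/s is kept in terms of m itself,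
since the limit of m is supplied by a separate estimate. -/
lemma exists_normal_limit (hc₀ : 0 < c₀) : ∃ K : ℝ, 0 ≤ K ∧
    ∀ α ∈ Icc (0 : ℝ) 1, ∀ x y z : ℝ → ℝ, IsScalarFrenet c₀ α x y z →
      (∀ s, x s ^ 2 + y s ^ 2 + z s ^ 2 = 1) →
      ∃ Z : ℂ, ∀ s, sZero c₀ ≤ s →
        ‖(z s + y s * I) - (exp (phase c₀ α 0 s * I) * Z
          + ((2 * curvature c₀ α s * x s * s⁻¹ : ℝ) : ℂ) * (beta α + α * I))‖
        ≤ K * (curvature c₀ α s * s⁻¹ ^ 2) := by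
  let K : ℝ := 12 + 8 * c₀ + 34 * c₀ ^ 2 + 8 * c₀ ^ 3 + 8 * c₀ ^ 4
  refine ⟨K + 4 + c₀ + 6 * c₀ ^ 2, by positivity, fun α hα x y z h hu => ?_⟩
  have ht : ∀ s, sZero c₀ ≤ s → 0 < s ∧ 0 < s⁻¹ ∧ s⁻¹ ≤ 1 := fun s hs => by
    have := (one_le_sZero c₀).trans hs
    exact ⟨by positivity, by positivity, inv_le_one_of_one_le₀ this⟩
  have hl := norm_rot hα
  have hderiv : ∀ s, sZero c₀ ≤ s → ∃ f', HasDerivAt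
      (fun s => exp (-(phase c₀ α 0 s * I)) * modNormal c₀ α x y z s) f' s ∧
      ‖f'‖ ≤ K * curvature c₀ α s * (α / 2 * s⁻¹ ^ 1 + (↑(1 : ℕ) + 1) * s⁻¹ ^ (1 + 2)) := by
    intro s hs
    obtain ⟨hs0, ht0, ht1⟩ := ht s hs
    obtain ⟨ρ, hρ, hδ, hφ⟩ := exists_phaseSpeed_eq (α := α) hc₀ hs0
    have h1 := (((hasDerivAt_phase c₀ α 0 hs).ofReal_comp.mul_const I).neg.cexp).mul
      (h.hasDerivAt_modNormal hα hs0.ne' (ρ := ρ) rfl)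
    rw [hφ] at h1
    refine ⟨_, h1, ?_⟩
    have hc := curvature_pos hc₀ α s
    have hE := norm_modNormal_error_le hc (curvature_le hc₀ hα.1 s) hα.1 ht0 ht1
      (beta_nonneg α) (beta_le_one α) hρ hδ (hu s) hl
    have hα0 := hα.1
    set E : ℂ := _ + _ * (_ + _ + _ + _) with hEdef
    have hexp : ‖exp (-(phase c₀ α 0 s * I))‖ = 1 := by
      rw [← neg_mul, ← ofReal_neg, norm_exp_ofReal_mul_I]
    have hEK : ‖E‖ ≤ K * curvature c₀ α s * (α / 2 * s⁻¹ ^ 1 + (↑(1 : ℕ) + 1) * s⁻¹ ^ (1 + 2)) := by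
      refine hE.trans ?_
      have a1 : 12 + 6 * c₀ + 22 * c₀ ^ 2 + 8 * c₀ ^ 3 + 8 * c₀ ^ 4 ≤ 2 * K := by
        simp only [K]; nlinarith [pow_pos hc₀ 2, pow_pos hc₀ 3, pow_pos hc₀ 4]
      have a2 : c₀ + 6 * c₀ ^ 2 ≤ K / 2 := by
        simp only [K]; nlinarith [pow_pos hc₀ 2, pow_pos hc₀ 3, pow_pos hc₀ 4]
      calc _ ≤ 2 * K * (curvature c₀ α s * s⁻¹ ^ 3) + K / 2 * (α * curvature c₀ α s * s⁻¹) := by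
            gcongr
        _ = _ := by push_cast; ring
    refine le_trans (le_of_eq ?_) hEK
    rw [← one_mul ‖E‖, ← hexp, ← norm_mul]
    congr 1
    simp only [Pi.neg_apply]
    ring
  choose! f' hf' hfle using hderiv
  obtain ⟨Z, -, hZ⟩ := exists_limit_of_norm_deriv_le hf'
    (fun s hs => hasDerivAt_curvature_mul_inv_pow c₀ α K 1 (ht s hs).1.ne') hfle
    (tendsto_curvature_mul_inv_pow hc₀ hα.1 K 1)
  refine ⟨Z, fun s hs => ?_⟩
  obtain ⟨hs0, ht0, ht1⟩ := ht s hs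
  have hc := curvature_pos hc₀ α s
  have hc1 := curvature_le hc₀ hα.1 s
  have hx : |x s| ≤ 1 := by
    rw [← sq_le_one_iff_abs_le_one]; nlinarith [hu s, sq_nonneg (y s), sq_nonneg (z s)]
  have hw' : ‖(z s - y s * I : ℂ)‖ ≤ 1 := by
    have := norm_add_mul_I_le (a := z s) (b := -y s) (by nlinarith [hu s, sq_nonneg (x s)])
    simpa [sub_eq_add_neg] using this
  have hexp : ‖exp (phase c₀ α 0 s * I)‖ = 1 := norm_exp_ofReal_mul_I _
  have e0 : ‖exp (phase c₀ α 0 s * I) *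
      (exp (-(phase c₀ α 0 s * I)) * modNormal c₀ α x y z s - Z)‖
      ≤ K * (curvature c₀ α s * s⁻¹ ^ 2) := by
    rw [norm_mul, hexp, one_mul]
    exact hZ s hs
  have e1 : ‖((curvature c₀ α s ^ 2 * s⁻¹ ^ 2 : ℝ) : ℂ) * (rot α ^ 2 * (z s - y s * I))‖
      ≤ c₀ * (curvature c₀ α s * s⁻¹ ^ 2) := by
    refine norm_ofReal_mul_le (M := 1) (by positivity) (by simpa [hl] using hw') ?_
    calc _ = curvature c₀ α s * (curvature c₀ α s * s⁻¹ ^ 2) := by ring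
      _ ≤ _ := by gcongr
  have e2 : ‖((curvature c₀ α s * s⁻¹ ^ 3 : ℝ) : ℂ) * (4 * I * rot α ^ 2 * x s)‖
      ≤ 4 * (curvature c₀ α s * s⁻¹ ^ 2) := by
    refine norm_ofReal_mul_le (M := 4) (by positivity) (by simpa [hl] using hx) ?_
    calc _ = 4 * (curvature c₀ α s * s⁻¹ ^ 2) * s⁻¹ := by ring
      _ ≤ _ := mul_le_of_le_one_right (by positivity) ht1
  have e3 : ‖((curvature c₀ α s ^ 3 * s⁻¹ ^ 3 : ℝ) : ℂ) *
      (2 * I * rot α * (rot α ^ 2 - 2 * beta α * I * rot α) * x s)‖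
      ≤ 6 * c₀ ^ 2 * (curvature c₀ α s * s⁻¹ ^ 2) := by
    refine norm_ofReal_mul_le (M := 6) (by positivity) ?_ ?_
    · have : ‖rot α ^ 2 - 2 * beta α * I * rot α‖ ≤ 3 := by
        refine (norm_sub_le _ _).trans ?_
        simp only [norm_mul, norm_pow, hl, norm_I, norm_real, Real.norm_eq_abs,
          abs_of_nonneg (beta_nonneg α), RCLike.norm_ofNat]
        linarith [beta_le_one α]
      rw [norm_mul, norm_mul _ (rot α ^ 2 - _)]
      simp only [norm_mul, hl, norm_I, norm_real, Real.norm_eq_abs, RCLike.norm_ofNat] at this ⊢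
      nlinarith [abs_nonneg (x s), norm_nonneg (rot α ^ 2 - 2 * beta α * I * rot α)]
    · calc _ = 6 * curvature c₀ α s ^ 2 * (curvature c₀ α s * s⁻¹ ^ 2) * s⁻¹ := by ring
        _ ≤ 6 * c₀ ^ 2 * (curvature c₀ α s * s⁻¹ ^ 2) * 1 := by gcongr
        _ = _ := by ring
  have hinv : exp (phase c₀ α 0 s * I) * exp (-(phase c₀ α 0 s * I)) = 1 := by
    rw [← exp_add, add_neg_cancel, exp_zero]
  have key : (z s + y s * I) - (exp (phase c₀ α 0 s * I) * Z
          + ((2 * curvature c₀ α s * x s * s⁻¹ : ℝ) : ℂ) * (beta α + α * I))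
      = exp (phase c₀ α 0 s * I) *
      (exp (-(phase c₀ α 0 s * I)) * modNormal c₀ α x y z s - Z)
      - ((curvature c₀ α s ^ 2 * s⁻¹ ^ 2 : ℝ) : ℂ) * (rot α ^ 2 * (z s - y s * I))
      - ((curvature c₀ α s * s⁻¹ ^ 3 : ℝ) : ℂ) * (4 * I * rot α ^ 2 * x s)
      + ((curvature c₀ α s ^ 3 * s⁻¹ ^ 3 : ℝ) : ℂ) *
      (2 * I * rot α * (rot α ^ 2 - 2 * beta α * I * rot α) * x s) := by
    rw [mul_sub, ← mul_assoc, hinv, modNormal]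
    push_cast
    -- This identity turns the first correction into the pair of coefficients β for b and α for n.
    have : 2 * I * rot α = -2 * (beta α + α * I) := by
      rw [rot]; linear_combination (2 * beta α : ℂ) * I_sq
    rw [this]
    ring
  rw [key]
  refine (norm_add_le_of_le (norm_sub_le_of_le (norm_sub_le_of_le e0 e1) e2) e3).trans
    (le_of_eq ?_)
  ring

end normal

/-! ### Combining the tangent and normal expansions. -/

section asymptotics

open Complex

/-- The data of a component at infinity and the expansions they enter. -/
structure HasAsymptotics (c₀ α K : ℝ) (x y z : ℝ → ℝ) (A : ℝ) (Z : ℂ) : Prop where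
  norm_sq : ‖Z‖ ^ 2 = 1 - A ^ 2
  near_x : ∀ s, sZero c₀ ≤ s → |x s - A| ≤ K * (curvature c₀ α s * s⁻¹)
  near_w : ∀ s, sZero c₀ ≤ s →
    ‖(z s + y s * I) - exp (phase c₀ α 0 s * I) * Z‖ ≤ K * (curvature c₀ α s * s⁻¹)
  expansion_w : ∀ s, sZero c₀ ≤ s →
    ‖(z s + y s * I) - (exp (phase c₀ α 0 s * I) * Z
      + ((2 * curvature c₀ α s * A * s⁻¹ : ℝ) : ℂ) * (beta α + α * I))‖
        ≤ K * (curvature c₀ α s * s⁻¹ ^ 2)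
  expansion_x : ∀ s, sZero c₀ ≤ s →
    |x s - (A - 2 * curvature c₀ α s * s⁻¹ *
        (α * (exp (phase c₀ α 0 s * I) * Z).im + beta α * (exp (phase c₀ α 0 s * I) * Z).re)
      - 2 * curvature c₀ α s ^ 2 * s⁻¹ ^ 2 * A)| ≤ K * (curvature c₀ α s * s⁻¹ ^ 3)

lemma norm_beta_add (hα : α ∈ Icc (0 : ℝ) 1) : ‖(beta α + α * I : ℂ)‖ = 1 := by
  rw [Complex.norm_add_mul_I, add_comm, sq_add_beta_sq hα, Real.sqrt_one]

lemma exists_hasAsymptotics {c₀ : ℝ} (hc₀ : 0 < c₀) : ∃ K : ℝ, 0 ≤ K ∧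
    ∀ α ∈ Icc (0 : ℝ) 1, ∀ x y z : ℝ → ℝ, IsScalarFrenet c₀ α x y z →
      (∀ s, x s ^ 2 + y s ^ 2 + z s ^ 2 = 1) → ∃ A Z, HasAsymptotics c₀ α K x y z A Z := by
  obtain ⟨K₁, hK₁, H₁⟩ := exists_tangent_limit hc₀
  obtain ⟨K₂, hK₂, H₂⟩ := exists_normal_limit hc₀
  refine ⟨K₁ + K₂ + 2 + 2 * c₀ * K₁ + 4 * c₀ * (K₂ + 2 * c₀ * K₁) + 2 * c₀ ^ 2 * K₁, by positivity,
    fun α hα x y z h hu => ?_⟩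
  obtain ⟨A, hA⟩ := H₁ α hα x y z h hu
  obtain ⟨Z, hZ⟩ := H₂ α hα x y z h hu
  set K := K₁ + K₂ + 2 + 2 * c₀ * K₁ + 4 * c₀ * (K₂ + 2 * c₀ * K₁) + 2 * c₀ ^ 2 * K₁ with hK
  have hc := fun s => curvature_pos hc₀ α s
  have hc1 := fun s => curvature_le hc₀ hα.1 s
  have hx : ∀ s, |x s| ≤ 1 := fun s => by
    rw [← sq_le_one_iff_abs_le_one]; nlinarith [hu s, sq_nonneg (y s), sq_nonneg (z s)]
  have ht : ∀ s, sZero c₀ ≤ s → 0 < s ∧ 0 < s⁻¹ ∧ s⁻¹ ≤ 1 := fun s hs => by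
    have := (one_le_sZero c₀).trans hs
    exact ⟨by positivity, by positivity, inv_le_one_of_one_le₀ this⟩
  have hnb := norm_beta_add hα
  have near_w : ∀ s, sZero c₀ ≤ s →
      ‖(z s + y s * I) - exp (phase c₀ α 0 s * I) * Z‖
        ≤ (K₂ + 2) * (curvature c₀ α s * s⁻¹) := by
    intro s hs
    obtain ⟨hs0, ht0, ht1⟩ := ht s hs
    have hcs := hc s
    have e1 : ‖((2 * curvature c₀ α s * s⁻¹ : ℝ) : ℂ) * (x s * (beta α + α * I))‖
        ≤ 2 * (curvature c₀ α s * s⁻¹) :=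
      norm_ofReal_mul_le (M := 1) (by positivity) (by simpa [hnb] using hx s) (by linarith)
    have e2 : K₂ * (curvature c₀ α s * s⁻¹ ^ 2) ≤ K₂ * (curvature c₀ α s * s⁻¹) := by
      gcongr
      exact pow_le_of_le_one ht0.le ht1 (by norm_num)
    have e3 : (z s + y s * I) - exp (phase c₀ α 0 s * I) * Z
        = ((z s + y s * I) - (exp (phase c₀ α 0 s * I) * Z
          + ((2 * curvature c₀ α s * x s * s⁻¹ : ℝ) : ℂ) * (beta α + α * I)))
          + ((2 * curvature c₀ α s * s⁻¹ : ℝ) : ℂ) * (x s * (beta α + α * I)) := by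
      push_cast; ring
    rw [e3]
    exact (norm_add_le_of_le ((hZ s hs).trans e2) e1).trans (le_of_eq (by ring))
  have expansion_w : ∀ s, sZero c₀ ≤ s →
      ‖(z s + y s * I) - (exp (phase c₀ α 0 s * I) * Z
        + ((2 * curvature c₀ α s * A * s⁻¹ : ℝ) : ℂ) * (beta α + α * I))‖
          ≤ (K₂ + 2 * c₀ * K₁) * (curvature c₀ α s * s⁻¹ ^ 2) := by
    intro s hs
    obtain ⟨hs0, ht0, ht1⟩ := ht s hs
    have hcs := hc s
    have e1 : ‖((2 * curvature c₀ α s * s⁻¹ : ℝ) : ℂ) * (((x s - A : ℝ) : ℂ) * (beta α + α * I))‖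
        ≤ 2 * c₀ * K₁ * (curvature c₀ α s * s⁻¹ ^ 2) := by
      refine norm_ofReal_mul_le (M := K₁ * (curvature c₀ α s * s⁻¹)) (by positivity) ?_ ?_
      · rw [norm_mul, hnb, mul_one, norm_real]
        exact (hA s hs).1
      · calc _ = 2 * curvature c₀ α s * K₁ * (curvature c₀ α s * s⁻¹ ^ 2) := by ring
          _ ≤ _ := by
            gcongr
            exact hc1 s
    have e3 : (z s + y s * I) - (exp (phase c₀ α 0 s * I) * Z
        + ((2 * curvature c₀ α s * A * s⁻¹ : ℝ) : ℂ) * (beta α + α * I))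
        = ((z s + y s * I) - (exp (phase c₀ α 0 s * I) * Z
          + ((2 * curvature c₀ α s * x s * s⁻¹ : ℝ) : ℂ) * (beta α + α * I)))
          + ((2 * curvature c₀ α s * s⁻¹ : ℝ) : ℂ) * (((x s - A : ℝ) : ℂ) * (beta α + α * I)) := by
      push_cast; ring
    rw [e3]
    exact (norm_add_le_of_le (hZ s hs) e1).trans (le_of_eq (by ring))
  have hlim : Tendsto (fun s => K * (curvature c₀ α s * s⁻¹)) atTop (𝓝 0) := by
    simpa using tendsto_curvature_mul_inv_pow hc₀ hα.1 K 0
  have p1 : 0 ≤ c₀ * K₁ := by positivity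
  have p2 : 0 ≤ c₀ * (K₂ + 2 * c₀ * K₁) := by positivity
  have p3 : 0 ≤ c₀ ^ 2 * K₁ := by positivity
  have near_x' : ∀ s, sZero c₀ ≤ s → |x s - A| ≤ K * (curvature c₀ α s * s⁻¹) := fun s hs =>
    (hA s hs).1.trans (mul_le_mul_of_nonneg_right (by linarith) (mul_pos (hc s) (ht s hs).2.1).le)
  have near_w' : ∀ s, sZero c₀ ≤ s →
      ‖(z s + y s * I) - exp (phase c₀ α 0 s * I) * Z‖ ≤ K * (curvature c₀ α s * s⁻¹) :=
    fun s hs => (near_w s hs).trans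
      (mul_le_mul_of_nonneg_right (by linarith) (mul_pos (hc s) (ht s hs).2.1).le)
  refine ⟨A, Z, ?_, near_x', near_w', fun s hs => (expansion_w s hs).trans ?_, fun s hs => ?_⟩
  -- The limits of m² and |w|² inherit the relation m² + |w|² = 1, as the phase factor does not
  -- affect the modulus.
  · have l1 : Tendsto x atTop (𝓝 A) := tendsto_iff_norm_sub_tendsto_zero.2
      (squeeze_zero' (.of_forall fun _ => norm_nonneg _)
        ((eventually_ge_atTop (sZero c₀)).mono near_x') hlim)
    have l2 : Tendsto (fun s => ‖(z s + y s * I : ℂ)‖) atTop (𝓝 ‖Z‖) := by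
      refine tendsto_iff_norm_sub_tendsto_zero.2 (squeeze_zero' (.of_forall fun _ => norm_nonneg _)
        ((eventually_ge_atTop (sZero c₀)).mono fun s hs => ?_) hlim)
      refine le_trans ?_ (near_w' s hs)
      have := abs_norm_sub_norm_le (z s + y s * I : ℂ) (exp (phase c₀ α 0 s * I) * Z)
      rwa [norm_mul, norm_exp_ofReal_mul_I, one_mul] at this
    refine tendsto_nhds_unique (l2.pow 2) (((l1.pow 2).const_sub 1).congr fun s => ?_)
    rw [Complex.norm_add_mul_I, Real.sq_sqrt (by positivity)]
    linarith [hu s]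
  · exact mul_le_mul_of_nonneg_right (by linarith) (mul_pos (hc s) (pow_pos (ht s hs).2.1 2)).le
  · obtain ⟨hs0, ht0, ht1⟩ := ht s hs
    have hcs := hc s
    have hcs1 := hc1 s
    have ew := expansion_w s hs
    set W := exp (phase c₀ α 0 s * I) * Z
    have ere := (abs_re_le_norm _).trans ew
    have eim := (abs_im_le_norm _).trans ew
    simp only [sub_re, add_re, sub_im, add_im, mul_re, mul_im, ofReal_re, ofReal_im, I_re, I_im,
      mul_zero, mul_one, zero_mul, sub_zero, add_zero, zero_add] at ere eim
    obtain ⟨e1, e2⟩ := hA s hs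
    have hα0 := hα.1
    have hα1 := hα.2
    have hb0 := beta_nonneg α
    have hb1 := beta_le_one α
    have hab := sq_add_beta_sq hα
    -- Inserting the expansion of n and b into αn + βb adds -4c²A/s², because α² + β² = 1. Together
    -- with +2c²m/s² this gives the coefficient -2 of c²A/s².
    have e3 : x s - (A - 2 * curvature c₀ α s * s⁻¹ * (α * W.im + beta α * W.re)
        - 2 * curvature c₀ α s ^ 2 * s⁻¹ ^ 2 * A)
        = (x s - (A - 2 * curvature c₀ α s * combX α y z s * s⁻¹
          + 2 * curvature c₀ α s ^ 2 * x s * s⁻¹ ^ 2))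
        - 2 * curvature c₀ α s * s⁻¹ * α *
          (y s - (W.im + 2 * curvature c₀ α s * A * s⁻¹ * α))
        - 2 * curvature c₀ α s * s⁻¹ * beta α *
          (z s - (W.re + 2 * curvature c₀ α s * A * s⁻¹ * beta α))
        + 2 * curvature c₀ α s ^ 2 * s⁻¹ ^ 2 * (x s - A) := by
      unfold combX
      linear_combination (-4 * curvature c₀ α s ^ 2 * s⁻¹ ^ 2 * A) * hab
    have e4 : ∀ γ e : ℝ, 0 ≤ γ → γ ≤ 1 →
        |e| ≤ (K₂ + 2 * c₀ * K₁) * (curvature c₀ α s * s⁻¹ ^ 2) →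
        |2 * curvature c₀ α s * s⁻¹ * γ * e|
          ≤ 2 * c₀ * (K₂ + 2 * c₀ * K₁) * (curvature c₀ α s * s⁻¹ ^ 3) := by
      intro γ e h0 h1 he
      rw [abs_mul, abs_of_nonneg (by positivity)]
      calc _ ≤ 2 * c₀ * s⁻¹ * 1 * ((K₂ + 2 * c₀ * K₁) * (curvature c₀ α s * s⁻¹ ^ 2)) := by gcongr
        _ = _ := by ring
    have e5 : |2 * curvature c₀ α s ^ 2 * s⁻¹ ^ 2 * (x s - A)|
        ≤ 2 * c₀ ^ 2 * K₁ * (curvature c₀ α s * s⁻¹ ^ 3) := by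
      rw [abs_mul, abs_of_nonneg (by positivity)]
      calc _ ≤ 2 * c₀ ^ 2 * s⁻¹ ^ 2 * (K₁ * (curvature c₀ α s * s⁻¹)) := by gcongr
        _ = _ := by ring
    rw [e3]
    refine ((abs_add_le _ _).trans (add_le_add ((abs_sub _ _).trans (add_le_add ((abs_sub _ _).trans
      (add_le_add e2 (e4 α _ hα0 hα1 eim))) (e4 _ _ hb0 hb1 ere))) e5)).trans ?_
    have : 0 ≤ curvature c₀ α s * s⁻¹ ^ 3 := by positivity
    rw [← add_mul, ← add_mul, ← add_mul]
    exact mul_le_mul_of_nonneg_right (by linarith) this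

end asymptotics

/-! ### Angles, and continuity in α of the data at infinity. -/

lemma exists_angle {Z : ℂ} {A : ℝ} (h : ‖Z‖ ^ 2 = 1 - A ^ 2) :
    ∃ a ∈ Ico (0 : ℝ) (2 * Real.pi),
      Real.sqrt (1 - A ^ 2) * Real.cos a = Z.re ∧ Real.sqrt (1 - A ^ 2) * Real.sin a = Z.im := by
  refine ⟨toIcoMod Real.two_pi_pos 0 Z.arg, by simpa using toIcoMod_mem_Ico Real.two_pi_pos 0 Z.arg, ?_⟩
  rw [← h, Real.sqrt_sq (norm_nonneg _), ← self_sub_toIcoDiv_zsmul, zsmul_eq_mul,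
    Real.cos_sub_int_mul_two_pi, Real.sin_sub_int_mul_two_pi]
  exact ⟨Complex.norm_mul_cos_arg Z, Complex.norm_mul_sin_arg Z⟩

lemma continuous_phase_param (c₀ a : ℝ) {s : ℝ} (hs : sZero c₀ ≤ s) :
    Continuous fun α => phase c₀ α a s := by
  have h0 := one_le_sZero c₀
  have h1 : 0 < (sZero c₀) ^ 2 / 4 := by positivity
  have h2 : (sZero c₀) ^ 2 / 4 ≤ s ^ 2 / 4 := by gcongr
  -- Replacing σ by a maximum changes nothing on the interval of integration and makes the integrand
  -- jointly continuous on the whole plane, away from the pole at σ = 0.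
  have hf : ∀ α : ℝ, (∫ σ in ((sZero c₀) ^ 2 / 4)..(s ^ 2 / 4),
      Real.sqrt (1 + c₀ ^ 2 * (Real.exp (-(2 * α * σ)) / σ)))
      = ∫ σ in ((sZero c₀) ^ 2 / 4)..(s ^ 2 / 4),
      Real.sqrt (1 + c₀ ^ 2 * (Real.exp (-(2 * α * σ)) / max σ ((sZero c₀) ^ 2 / 4))) := by
    intro α
    refine intervalIntegral.integral_congr fun σ hσ => ?_
    rw [uIcc_of_le h2] at hσ
    simp only [max_eq_left hσ.1]
  unfold phase
  simp only [hf]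
  refine continuous_const.add (continuous_beta.mul
    (intervalIntegral.continuous_parametric_intervalIntegral_of_continuous' ?_ _ _))
  have : ∀ p : ℝ × ℝ, max p.2 ((sZero c₀) ^ 2 / 4) ≠ 0 := fun p =>
    (lt_max_of_lt_right h1).ne'
  unfold Function.uncurry
  fun_prop (disch := exact this _)

/-- The rate does not depend on α, so L is a uniform limit of continuous functions. -/
lemma continuousOn_of_norm_sub_le {E : Type*} [NormedAddCommGroup E] {F : ℝ → ℝ → E} {L : ℝ → E}
    {S : Set ℝ} {s₀ C : ℝ} (hF : ∀ s, s₀ ≤ s → ContinuousOn (F s) S)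
    (h : ∀ s, s₀ ≤ s → ∀ α ∈ S, ‖F s α - L α‖ ≤ C * s⁻¹) : ContinuousOn L S := by
  refine TendstoUniformlyOn.continuousOn (F := F) (p := atTop) ?_
    ((eventually_ge_atTop s₀).mono hF).frequently
  rw [Metric.tendstoUniformlyOn_iff]
  intro ε hε
  have : Tendsto (fun s : ℝ => C * s⁻¹) atTop (𝓝 0) := by
    simpa using tendsto_inv_atTop_zero.const_mul C
  filter_upwards [eventually_ge_atTop s₀, this.eventually (gt_mem_nhds hε)] with s hs hsε α hα
  rw [dist_comm, dist_eq_norm]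
  exact (h s hs α hα).trans_lt hsε

lemma continuousOn_E3 {f : ℝ → E3} {S : Set ℝ} (h : ∀ j, ContinuousOn (fun α => f α j) S) :
    ContinuousOn f S :=
  (PiLp.continuous_toLp 2 _).comp_continuousOn (continuousOn_pi.2 h)

lemma norm_E3_le {v : E3} {B : ℝ} (h : ∀ j, |v j| ≤ B) : ‖v‖ ≤ 3 * B := by
  have hB : 0 ≤ B := (abs_nonneg _).trans (h 0)
  rw [EuclideanSpace.norm_eq]
  refine Real.sqrt_le_iff.2 ⟨by positivity, ?_⟩
  have : ∀ j, ‖v j‖ ^ 2 ≤ B ^ 2 := fun j => pow_le_pow_left₀ (norm_nonneg _) (h j) 2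
  rw [Fin.sum_univ_three]
  nlinarith [this 0, this 1, this 2, sq_nonneg B]

lemma exp_phase_mul (c₀ α a s r : ℝ) {Z : ℂ} (hre : r * Real.cos a = Z.re)
    (him : r * Real.sin a = Z.im) :
    (Complex.exp (phase c₀ α 0 s * Complex.I) * Z).re = r * Real.cos (phase c₀ α a s) ∧
    (Complex.exp (phase c₀ α 0 s * Complex.I) * Z).im = r * Real.sin (phase c₀ α a s) := by
  rw [phase_eq_add c₀ α a, Complex.mul_re, Complex.mul_im, Complex.exp_ofReal_mul_I_re,
    Complex.exp_ofReal_mul_I_im, ← hre, ← him, Real.cos_add, Real.sin_add]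
  constructor <;> ring

lemma curvature_sq (c₀ α s : ℝ) :
    curvature c₀ α s ^ 2 = c₀ ^ 2 * Real.exp (-(α * s ^ 2) / 2) := by
  rw [curvature, mul_pow, ← Real.exp_nat_mul]
  congr 2
  push_cast
  ring

section limits

variable {c₀ K : ℝ} {x y z : ℝ → ℝ → ℝ} {A : ℝ → ℝ} {Z : ℝ → ℂ}

lemma HasAsymptotics.tendsto_x {α A : ℝ} {x y z : ℝ → ℝ} {Z : ℂ} (hc₀ : 0 < c₀) (hα : 0 ≤ α)
    (h : HasAsymptotics c₀ α K x y z A Z) : Tendsto x atTop (𝓝 A) := by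
  refine tendsto_iff_norm_sub_tendsto_zero.2 (squeeze_zero' (.of_forall fun _ => norm_nonneg _)
    ((eventually_ge_atTop (sZero c₀)).mono h.near_x) ?_)
  simpa using tendsto_curvature_mul_inv_pow hc₀ hα K 0

lemma continuousOn_tangent_limit (hc₀ : 0 < c₀) (hK : 0 ≤ K)
    (hx : ∀ s, 0 ≤ s → ContinuousOn (fun α => x α s) (Icc 0 1))
    (h : ∀ α ∈ Icc (0 : ℝ) 1, HasAsymptotics c₀ α K (x α) (y α) (z α) (A α) (Z α)) :
    ContinuousOn A (Icc 0 1) := by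
  have h0 := one_le_sZero c₀
  refine continuousOn_of_norm_sub_le (F := fun s α => x α s) (s₀ := sZero c₀) (C := K * c₀)
    (fun s hs => hx s (by linarith)) fun s hs α hα => ((h α hα).near_x s hs).trans ?_
  have : 0 ≤ s⁻¹ := inv_nonneg.2 (by linarith)
  rw [mul_assoc]
  gcongr
  exact curvature_le hc₀ hα.1 s

/-- Z is the uniform limit of e^{-iφ}(b + i n), and φ is continuous in α at fixed s. -/
lemma continuousOn_normal_limit (hc₀ : 0 < c₀) (hK : 0 ≤ K)
    (hy : ∀ s, 0 ≤ s → ContinuousOn (fun α => y α s) (Icc 0 1))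
    (hz : ∀ s, 0 ≤ s → ContinuousOn (fun α => z α s) (Icc 0 1))
    (h : ∀ α ∈ Icc (0 : ℝ) 1, HasAsymptotics c₀ α K (x α) (y α) (z α) (A α) (Z α)) :
    ContinuousOn Z (Icc 0 1) := by
  have h0 := one_le_sZero c₀
  refine continuousOn_of_norm_sub_le (s₀ := sZero c₀) (C := K * c₀)
    (F := fun s α => Complex.exp (-(phase c₀ α 0 s * Complex.I))
      * (z α s + y α s * Complex.I)) (fun s hs => ?_) fun s hs α hα => ?_
  · have h1 := (continuous_phase_param c₀ 0 hs).continuousOn (s := Icc 0 1)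
    have h2 := hy s (by linarith)
    have h3 := hz s (by linarith)
    have o := Complex.continuous_ofReal
    exact ((o.comp_continuousOn h1).mul continuousOn_const).neg.cexp.mul
      ((o.comp_continuousOn h3).add ((o.comp_continuousOn h2).mul continuousOn_const))
  · have e : Complex.exp (-(phase c₀ α 0 s * Complex.I)) * (z α s + y α s * Complex.I) - Z α
        = Complex.exp (-(phase c₀ α 0 s * Complex.I)) * ((z α s + y α s * Complex.I)
          - Complex.exp (phase c₀ α 0 s * Complex.I) * Z α) := by
      rw [mul_sub _ _ (_ * Z α), ← mul_assoc, ← Complex.exp_add, neg_add_cancel, Complex.exp_zero,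
        one_mul]
    have hexp : ‖Complex.exp (-(phase c₀ α 0 s * Complex.I))‖ = 1 := by
      rw [← neg_mul, ← Complex.ofReal_neg, Complex.norm_exp_ofReal_mul_I]
    rw [e, norm_mul, hexp, one_mul]
    refine ((h α hα).near_w s hs).trans ?_
    have : 0 ≤ s⁻¹ := inv_nonneg.2 (by linarith)
    rw [mul_assoc]
    gcongr
    exact curvature_le hc₀ hα.1 s

end limits

/-- The componentwise asymptotics give the expansions of the three vectors. -/
lemma expansion_of_component {c₀ α K : ℝ} {m n b : ℝ → E3} {A a : E3} {Z : Fin 3 → ℂ}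
    (h : ∀ j, HasAsymptotics c₀ α K (fun s => m s j) (fun s => n s j) (fun s => b s j)
      (A j) (Z j))
    (hre : ∀ j, Real.sqrt (1 - A j ^ 2) * Real.cos (a j) = (Z j).re)
    (him : ∀ j, Real.sqrt (1 - A j ^ 2) * Real.sin (a j) = (Z j).im) {s : ℝ}
    (hs : sZero c₀ ≤ s) :
    ‖m s - mainM c₀ α A a s‖ ≤ 3 * K * c₀ * (Real.exp (-(α * s ^ 2) / 4) / s ^ 3) ∧
    ‖n s - mainN c₀ α A a s‖ ≤ 3 * K * c₀ * (Real.exp (-(α * s ^ 2) / 4) / s ^ 2) ∧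
    ‖b s - mainB c₀ α A a s‖ ≤ 3 * K * c₀ * (Real.exp (-(α * s ^ 2) / 4) / s ^ 2) := by
  have e : ∀ k, 3 * (K * (curvature c₀ α s * s⁻¹ ^ k))
      = 3 * K * c₀ * (Real.exp (-(α * s ^ 2) / 4) / s ^ k) := fun k => by
    rw [curvature, inv_pow]; ring
  rw [← e, ← e]
  refine ⟨norm_E3_le fun j => ?_, norm_E3_le fun j => ?_, norm_E3_le fun j => ?_⟩
  · have h1 := (h j).expansion_x s hs
    obtain ⟨e1, e2⟩ := exp_phase_mul c₀ α (a j) s _ (hre j) (him j)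
    rw [e1, e2, curvature_sq] at h1
    refine le_trans (le_of_eq ?_) h1
    congr 1
    simp only [mainM, ampSin, ampCos, amplitude, curvature, PiLp.sub_apply, PiLp.add_apply,
      PiLp.smul_apply, smul_eq_mul]
    ring
  · have h1 := (Complex.abs_im_le_norm _).trans ((h j).expansion_w s hs)
    obtain ⟨-, e2⟩ := exp_phase_mul c₀ α (a j) s _ (hre j) (him j)
    rw [Complex.sub_im, Complex.add_im, Complex.add_im, e2] at h1
    simp only [Complex.add_re, Complex.add_im, Complex.mul_re, Complex.mul_im, Complex.ofReal_re,
      Complex.ofReal_im, Complex.I_re, Complex.I_im, mul_zero, mul_one, zero_mul, sub_zero,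
      add_zero, zero_add] at h1
    refine le_trans (le_of_eq ?_) h1
    congr 1
    simp only [mainN, ampSin, amplitude, curvature, PiLp.sub_apply, PiLp.add_apply,
      PiLp.smul_apply, smul_eq_mul]
    ring
  · have h1 := (Complex.abs_re_le_norm _).trans ((h j).expansion_w s hs)
    obtain ⟨e1, -⟩ := exp_phase_mul c₀ α (a j) s _ (hre j) (him j)
    rw [Complex.sub_re, Complex.add_re, Complex.add_re, e1] at h1
    simp only [Complex.add_re, Complex.add_im, Complex.mul_re, Complex.mul_im, Complex.ofReal_re,
      Complex.ofReal_im, Complex.I_re, Complex.I_im, mul_zero, mul_one, zero_mul, sub_zero,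
      add_zero, zero_add] at h1
    refine le_trans (le_of_eq ?_) h1
    congr 1
    simp only [mainB, ampCos, amplitude, curvature, PiLp.sub_apply, PiLp.add_apply,
      PiLp.smul_apply, smul_eq_mul]
    ring

/-- The angles themselves may jump. The addition formulas express the main terms through B sin a and
B cos a, the imaginary and real parts of Z, which are continuous. -/
lemma continuousOn_main {c₀ : ℝ} {A a : ℝ → E3} {S : Set ℝ} (hA : ContinuousOn A S)
    (hsin : ∀ j, ContinuousOn (fun α => amplitude (A α) j * Real.sin (a α j)) S)
    (hcos : ∀ j, ContinuousOn (fun α => amplitude (A α) j * Real.cos (a α j)) S) {s : ℝ}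
    (hs : sZero c₀ ≤ s) :
    ContinuousOn (fun α => mainM c₀ α (A α) (a α) s) S ∧
    ContinuousOn (fun α => mainN c₀ α (A α) (a α) s) S ∧
    ContinuousOn (fun α => mainB c₀ α (A α) (a α) s) S := by
  have hφ := (continuous_phase_param c₀ 0 hs).continuousOn (s := S)
  have hc := Real.continuous_cos.comp_continuousOn hφ
  have hs' := Real.continuous_sin.comp_continuousOn hφ
  have hβ := continuous_beta.continuousOn (s := S)
  have hS : ContinuousOn (fun α => ampSin c₀ α (A α) (a α) s) S := by
    refine continuousOn_E3 fun j => (((hsin j).mul hc).add ((hcos j).mul hs')).congr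
      fun α _ => ?_
    simp only [ampSin, Pi.add_apply, Pi.mul_apply, Function.comp_apply]
    rw [phase_eq_add, Real.sin_add]
    ring
  have hC : ContinuousOn (fun α => ampCos c₀ α (A α) (a α) s) S := by
    refine continuousOn_E3 fun j => (((hcos j).mul hc).sub ((hsin j).mul hs')).congr
      fun α _ => ?_
    simp only [ampCos, Pi.sub_apply, Pi.mul_apply, Function.comp_apply]
    rw [phase_eq_add, Real.cos_add]
    ring
  unfold mainM mainN mainB
  refine ⟨?_, ?_, ?_⟩ <;> fun_prop

end LLG

/-! ### Assembly of the theorem. -/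

theorem theorem2 (c₀ : ℝ) (hc₀ : 0 < c₀) :
    ∃ C : ℝ, 0 < C ∧
      ∀ m n b : ℝ → ℝ → LLG.E3,
        (∀ α ∈ Set.Icc (0 : ℝ) 1, LLG.IsFrenetSolution c₀ α (m α) (n α) (b α)) →
        -- (i) symmetries (components are numbered 0, 1, 2)
        (∀ α ∈ Set.Icc (0 : ℝ) 1,
          (Function.Even (fun s => m α s 0) ∧
            Function.Odd (fun s => m α s 1) ∧ Function.Odd (fun s => m α s 2)) ∧
          (Function.Odd (fun s => n α s 0) ∧
            Function.Even (fun s => n α s 1) ∧ Function.Even (fun s => n α s 2)) ∧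
          (Function.Odd (fun s => b α s 0) ∧
            Function.Even (fun s => b α s 1) ∧ Function.Even (fun s => b α s 2))) ∧
        -- (ii) asymptotics, with errors uniform in α and continuous dependence on α
        ∃ A a : ℝ → LLG.E3,
          (∀ α ∈ Set.Icc (0 : ℝ) 1,
            ‖A α‖ = 1 ∧
            (∀ j, a α j ∈ Set.Ico 0 (2 * Real.pi)) ∧
            ∀ s : ℝ, LLG.sZero c₀ ≤ s →
              ‖m α s - LLG.mainM c₀ α (A α) (a α) s‖
                  ≤ C * (Real.exp (-(α * s ^ 2) / 4) / s ^ 3) ∧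
              ‖n α s - LLG.mainN c₀ α (A α) (a α) s‖
                  ≤ C * (Real.exp (-(α * s ^ 2) / 4) / s ^ 2) ∧
              ‖b α s - LLG.mainB c₀ α (A α) (a α) s‖
                  ≤ C * (Real.exp (-(α * s ^ 2) / 4) / s ^ 2)) ∧
          ContinuousOn A (Set.Icc 0 1) ∧
          ContinuousOn (fun α => LLG.amplitude (A α)) (Set.Icc 0 1) ∧
          (∀ j, ContinuousOn (fun α => LLG.amplitude (A α) j * Real.sin (a α j)) (Set.Icc 0 1)) ∧
          (∀ j, ContinuousOn (fun α => LLG.amplitude (A α) j * Real.cos (a α j)) (Set.Icc 0 1)) ∧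
          (∀ s : ℝ, LLG.sZero c₀ ≤ s →
            ContinuousOn (fun α => m α s - LLG.mainM c₀ α (A α) (a α) s) (Set.Icc 0 1) ∧
            ContinuousOn (fun α => n α s - LLG.mainN c₀ α (A α) (a α) s) (Set.Icc 0 1) ∧
            ContinuousOn (fun α => b α s - LLG.mainB c₀ α (A α) (a α) s) (Set.Icc 0 1)) := by
  obtain ⟨K, hK, H⟩ := LLG.exists_hasAsymptotics hc₀
  -- The added 1 ensures strict positivity, since only 0 ≤ `K` is known.
  refine ⟨3 * K * c₀ + 1, by positivity, fun m n b hsol => ⟨fun α hα => ?_, ?_⟩⟩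
  · have h := hsol α hα
    obtain ⟨a1, a2, a3⟩ := (h.component 0).even_odd_odd (by simp [h.init_n]) (by simp [h.init_b])
    obtain ⟨b1, b2, b3⟩ := (h.component 1).odd_even_even (by simp [h.init_m])
    obtain ⟨d1, d2, d3⟩ := (h.component 2).odd_even_even (by simp [h.init_m])
    exact ⟨⟨a1, b1, d1⟩, ⟨a2, b2, d2⟩, a3, b3, d3⟩
  have H' : ∀ α j, α ∈ Set.Icc (0 : ℝ) 1 → ∃ (A a : ℝ) (Z : ℂ),
      LLG.HasAsymptotics c₀ α K (fun s => m α s j) (fun s => n α s j) (fun s => b α s j) A Z ∧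
      a ∈ Set.Ico 0 (2 * Real.pi) ∧ Real.sqrt (1 - A ^ 2) * Real.cos a = Z.re ∧
      Real.sqrt (1 - A ^ 2) * Real.sin a = Z.im := by
    intro α j hα
    obtain ⟨A, Z, h⟩ := H α hα _ _ _ ((hsol α hα).component j) ((hsol α hα).unit_component j)
    obtain ⟨a, ha, h1, h2⟩ := LLG.exists_angle h.norm_sq
    exact ⟨A, a, Z, h, ha, h1, h2⟩
  choose! A a Z hasy ha hre him using H'
  have hcomp := fun j s (hs : 0 ≤ s) => LLG.continuousOn_component hc₀.le hsol j hs
  have hA : ContinuousOn (fun α => (WithLp.toLp 2 (A α) : LLG.E3)) (Set.Icc 0 1) :=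
    LLG.continuousOn_E3 fun j => LLG.continuousOn_tangent_limit hc₀ hK
      (fun s hs => (hcomp j s hs).1) fun α hα => hasy α j hα
  have hZ : ∀ j, ContinuousOn (fun α => Z α j) (Set.Icc 0 1) := fun j =>
    LLG.continuousOn_normal_limit hc₀ hK (fun s hs => (hcomp j s hs).2.1)
      (fun s hs => (hcomp j s hs).2.2) fun α hα => hasy α j hα
  have hsin : ∀ j, ContinuousOn (fun α => LLG.amplitude (WithLp.toLp 2 (A α)) j *
      Real.sin ((WithLp.toLp 2 (a α) : LLG.E3) j)) (Set.Icc 0 1) := fun j =>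
    (Complex.continuous_im.comp_continuousOn (hZ j)).congr fun α hα => him α j hα
  have hcos : ∀ j, ContinuousOn (fun α => LLG.amplitude (WithLp.toLp 2 (A α)) j *
      Real.cos ((WithLp.toLp 2 (a α) : LLG.E3) j)) (Set.Icc 0 1) := fun j =>
    (Complex.continuous_re.comp_continuousOn (hZ j)).congr fun α hα => hre α j hα
  refine ⟨fun α => WithLp.toLp 2 (A α), fun α => WithLp.toLp 2 (a α), fun α hα =>
    ⟨?_, fun j => ha α j hα, fun s hs => ?_⟩, hA, ?_, hsin, hcos, fun s hs => ?_⟩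
  -- A is a unit vector as the limit of the unit vectors m(s).
  · have hlim : Filter.Tendsto (m α) Filter.atTop (nhds (WithLp.toLp 2 (A α))) := by
      refine ((PiLp.continuous_toLp 2 _).tendsto (A α)).comp (f := fun s j => m α s j)
        (tendsto_pi_nhds.2 fun j => (hasy α j hα).tendsto_x hc₀ hα.1)
    refine tendsto_nhds_unique hlim.norm ?_
    simp only [(hsol α hα).norm_m]
    exact tendsto_const_nhds
  · have h0 : 0 < s := by linarith [LLG.one_le_sZero c₀]
    obtain ⟨h1, h2, h3⟩ := LLG.expansion_of_component (A := WithLp.toLp 2 (A α))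
      (a := WithLp.toLp 2 (a α)) (fun j => hasy α j hα) (fun j => hre α j hα)
      (fun j => him α j hα) hs
    refine ⟨h1.trans ?_, h2.trans ?_, h3.trans ?_⟩ <;>
    · gcongr
      linarith
  · have hA' : ∀ j, ContinuousOn (fun α => A α j) (Set.Icc 0 1) := fun j =>
      (EuclideanSpace.proj (𝕜 := ℝ) j).continuous.comp_continuousOn hA
    exact LLG.continuousOn_E3 fun j => (continuousOn_const.sub ((hA' j).pow 2)).sqrt
  · obtain ⟨h1, h2, h3⟩ := LLG.continuousOn_main hA hsin hcos hs
    have h0 : 0 ≤ s := by linarith [LLG.one_le_sZero c₀]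
    exact ⟨(LLG.continuousOn_E3 fun j => (hcomp j s h0).1).sub h1,
      (LLG.continuousOn_E3 fun j => (hcomp j s h0).2.1).sub h2,
      (LLG.continuousOn_E3 fun j => (hcomp j s h0).2.2).sub h3⟩
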